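/- Let $\mathcal H$ be a complex Hilbert space, let $D$ be a self-adjoint (possibly unbounded, not necessarily injective) operator on $\mathcal H$ with domain $\mathsf D(D)$, and let $B$ be a bounded operator on $\mathcal H$ which is strictly accretive on the range of $D$: there is $\delta>0$ with $\mathrm{Re}\,(BDu,Du)\ge\delta\|Du\|^2$ for all $u\in\mathsf D(D)$. Let $k\ge 1$ be an integer. Write $BD$ for the operator $u\mapsto B(Du)$ with domain $\mathsf D(BD)=\mathsf D(D)$, and $\mathsf N(BD)$, $\mathsf R(BD)$ for its null space and range. Under these assumptions $Q_t^B:=t^kBD(I+t^{2k}BDBD)^{-1}$ is a bounded operator on $\mathcal H$ for every $t>0$, and so is $Q_t^{B^*}$, defined with $B^*$ in place of $B$. The operator $\mathrm{sgn}(BD)$ is defined as the closure of the operator $$f\mapsto c\int_0^\infty (Q_t^B)^3 f\,\frac{dt}{t},\qquad c^{-1}=\int_0^\infty u^{3k-1}(1+u^{2k})^{-3}\,du,$$ on $\mathsf N(BD)+(\mathsf D(BD)\cap\mathsf R(BD))$, where the integral converges absolutely in $\mathcal H$ (and is $0$ on $\mathsf N(BD)$). Proposition 1.2 (cor:main). Suppose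 that there is a constant $C<\infty$ such that for all $u\in\mathcal H$ $$\int_0^\infty\|Q_t^Bu\|^2\,\frac{dt}{t}\le C\|u\|^2\qquad\text{and}\qquad \int_0^\infty\|Q_t^{B^*}u\|^2\,\frac{dt}{t}\le C\|u\|^2 .$$ Then $\mathrm{sgn}(BD)$ is a bounded operator defined on all of $\mathcal H$, and it is invertible on $\overline{\mathsf R(BD)}$: it restricts to an isomorphism (linear homeomorphism) of $\overline{\mathsf R(BD)}$ onto itself. -/

import Mathlib

open MeasureTheory Set
open scoped ENNReal NNReal

noncomputable section

namespace SgnBD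

variable {H : Type*} [NormedAddCommGroup H] [InnerProductSpace ℂ H] [CompleteSpace H]

/-- The unbounded operator `BD`, with domain `D(BD) = D(D)`. -/
def mulOp (B : H →L[ℂ] H) (D : H →ₗ.[ℂ] H) : H →ₗ.[ℂ] H :=
  (B : H →ₗ[ℂ] H).compPMap D

/-- The range of an unbounded operator. -/
def ran (T : H →ₗ.[ℂ] H) : Submodule ℂ H := LinearMap.range T.toFun

/-- The null space of an unbounded operator, as a subspace of the whole space. -/
def nul (T : H →ₗ.[ℂ] H) : Submodule ℂ H := (LinearMap.ker T.toFun).map T.domain.subtype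

/-- `B` is strictly accretive on the range of `D`. -/
def StrictlyAccretiveOnRange (B : H →L[ℂ] H) (D : H →ₗ.[ℂ] H) : Prop :=
  ∃ δ : ℝ, 0 < δ ∧ ∀ u : D.domain, δ * ‖D u‖ ^ 2 ≤ (inner ℂ (B (D u)) (D u)).re

/-- `Q` is the bounded operator `sT (I + s² T²)⁻¹`: the operator `I + s² T²`, with domain
`D(T²) = {w ∈ D(T) : Tw ∈ D(T)}`, is a bijection onto the whole space, and `Q` sends
`(I + s² T²) w` to `s T w`. There is at most one such `Q`. -/
def IsQ (T : H →ₗ.[ℂ] H) (s : ℝ) (Q : H →L[ℂ] H) : Prop :=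
  (∀ u : H, ∃! w : H, ∃ (h : w ∈ T.domain) (h' : T ⟨w, h⟩ ∈ T.domain),
      w + (s : ℂ) ^ 2 • T ⟨T ⟨w, h⟩, h'⟩ = u) ∧
  ∀ (w : H) (h : w ∈ T.domain) (h' : T ⟨w, h⟩ ∈ T.domain),
      Q (w + (s : ℂ) ^ 2 • T ⟨T ⟨w, h⟩, h'⟩) = (s : ℂ) • T ⟨w, h⟩

open Classical in
/-- The operator `sT (I + s² T²)⁻¹` (with the value `0` should it fail to exist as a bounded
everywhere defined operator; it exists for every bisectorial `T`). -/
def qOp (T : H →ₗ.[ℂ] H) (s : ℝ) : H →L[ℂ] H :=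
  if h : ∃ Q : H →L[ℂ] H, IsQ T s Q then h.choose else 0

/-- The quadratic estimate
`∫₀^∞ ‖t^k T (I + t^{2k} T²)⁻¹ u‖² dt/t ≤ C ‖u‖²` for all `u`, with a finite constant `C`. -/
def QuadraticEstimate (k : ℕ) (T : H →ₗ.[ℂ] H) : Prop :=
  ∃ C : ℝ≥0, ∀ u : H,
    ∫⁻ t in Ioi (0 : ℝ), ‖qOp T (t ^ k) u‖ₑ ^ 2 / ENNReal.ofReal t ≤ C * ‖u‖ₑ ^ 2

/-- The normalising constant, `c⁻¹ = ∫₀^∞ u^{3k-1} (1 + u^{2k})⁻³ du`. -/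
def sgnConst (k : ℕ) : ℝ := (∫ u in Ioi (0 : ℝ), u ^ (3 * k - 1) / (1 + u ^ (2 * k)) ^ 3)⁻¹

/-- The integrand `(t^k T (I + t^{2k} T²)⁻¹)³ f / t`. -/
def sgnIntegrand (k : ℕ) (T : H →ₗ.[ℂ] H) (f : H) (t : ℝ) : H :=
  (t : ℂ)⁻¹ • (qOp T (t ^ k) ^ 3) f

/-- The operator `f ↦ c ∫₀^∞ (t^k T (I + t^{2k} T²)⁻¹)³ f dt/t` on `N(T) + (D(T) ∩ R(T))`.
On `N(T)` the integrand vanishes, and for bisectorial `T` it is `O(min (t^k, t^{-k}))/t` on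
`D(T) ∩ R(T)`, so that the absolute convergence in the definition of the domain is automatic. -/
def sgnCore (k : ℕ) (T : H →ₗ.[ℂ] H) : H →ₗ.[ℂ] H where
  domain :=
    { carrier := {f | f ∈ nul T ⊔ (T.domain ⊓ ran T) ∧
        IntegrableOn (sgnIntegrand k T f) (Ioi (0 : ℝ))}
      zero_mem' := by
        refine ⟨Submodule.zero_mem _, ?_⟩
        have : sgnIntegrand k T (0 : H) = fun _ => 0 := by
          funext t; simp [sgnIntegrand]
        rw [this]
        exact integrableOn_zero
      add_mem' := by
        rintro f g ⟨hf, hf'⟩ ⟨hg, hg'⟩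
        refine ⟨Submodule.add_mem _ hf hg, ?_⟩
        have : sgnIntegrand k T (f + g) = sgnIntegrand k T f + sgnIntegrand k T g := by
          funext t; simp [sgnIntegrand]
        rw [this]
        exact hf'.add hg'
      smul_mem' := by
        rintro a f ⟨hf, hf'⟩
        refine ⟨Submodule.smul_mem _ a hf, ?_⟩
        have : sgnIntegrand k T (a • f) = a • sgnIntegrand k T f := by
          funext t; simp [sgnIntegrand, smul_comm a]
        rw [this]
        exact hf'.smul a }
  toFun :=
    { toFun := fun f => (sgnConst k : ℂ) • ∫ t in Ioi (0 : ℝ), sgnIntegrand k T f t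
      map_add' := by
        rintro ⟨f, hf, hf'⟩ ⟨g, hg, hg'⟩
        have : ∀ t, sgnIntegrand k T (f + g) t = sgnIntegrand k T f t + sgnIntegrand k T g t := by
          intro t; simp [sgnIntegrand]
        simp only [Submodule.coe_add, this]
        rw [integral_add hf' hg', smul_add]
      map_smul' := by
        rintro a ⟨f, hf, hf'⟩
        have : ∀ t, sgnIntegrand k T (a • f) t = a • sgnIntegrand k T f t := by
          intro t; simp [sgnIntegrand, smul_comm a]
        simp only [Submodule.coe_smul, this, RingHom.id_apply]
        rw [integral_smul, smul_comm] }

/-- The operator `sgn(T)`: the closure of the operator given by the integral formula on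
`N(T) + (D(T) ∩ R(T))`. -/
def sgn (k : ℕ) (T : H →ₗ.[ℂ] H) : H →ₗ.[ℂ] H := (sgnCore k T).closure

end SgnBD

end

set_option linter.unusedSectionVars false

namespace SgnBD

open Complex Filter Topology

variable {H : Type*} [NormedAddCommGroup H] [InnerProductSpace ℂ H] [CompleteSpace H]

section

open ContinuousLinearMap

/-! ### Self-adjoint operators and multiplicative perturbations -/

/-! Write `T = BD`, `R s = (I + isT)⁻¹`, and, for `s = t ^ k`, `p = (I + s²T²)⁻¹` and `q = sT(I +
s²T²)⁻¹`.

Boundedness is a duality argument. In `(x, q³ f) = (q* x, q (q f))` the factor `q f` is controlled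
by the quadratic estimate for `B`. The factor `q* x` is controlled by the one for `B*`: formally `B*
q* = q' B*`, with `q'` built from `B*D`, and `B*` is bounded below on the closure of `R(D)`, which
contains the range of `q*`. So the truncated integrals of `q³ dt/t` are uniformly bounded
(`norm_intervalIntegral_pow_le`, `norm_adjoint_resQ_le`). They converge on the dense subspace of
`dense_nul_sup`, hence strongly everywhere, and the closure is a bounded operator `S`.

Invertibility comes from the scalar identity `exp (2i arctan x) = (1 + ix)/(1 - ix)`. Integration by
parts turns `16k ∫ q³ dt/t` into `2k ∫ q dt/t` plus bounded boundary terms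
(`intervalIntegral_pow_eq`). The exponential of `2ik ∫ q dt/t` carries the Cayley transform `(I +
isT)(I - isT)⁻¹` at the lower endpoint to the one at the upper endpoint
(`exp_intervalIntegral_mul`). On the closure of `R(T)` these transforms tend strongly to `I` as `t →
0` and to `-I` as `t → ∞`, and the boundary terms vanish. Since the normalising constant is `16k/π`,
the limit reads `exp (iπS) = -I` there (`exp_smul_apply_eq_neg`). By spectral mapping `0` is not in
the spectrum of the restriction of `S`. -/

lemma mem_graph_mulOp {B : H →L[ℂ] H} {D : H →ₗ.[ℂ] H} {u w : H} :
    (u, w) ∈ (mulOp B D).graph ↔ ∃ v, (u, v) ∈ D.graph ∧ B v = w := by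
  simp only [LinearPMap.mem_graph_iff]
  constructor
  · rintro ⟨y, hy, hw⟩
    exact ⟨D y, ⟨y, hy, rfl⟩, hw⟩
  · rintro ⟨v, ⟨y, hy, rfl⟩, hw⟩
    exact ⟨y, hy, hw⟩

lemma mem_ran {T : H →ₗ.[ℂ] H} {v : H} : v ∈ ran T ↔ ∃ u, (u, v) ∈ T.graph := by
  simp only [ran, LinearMap.mem_range, LinearPMap.mem_graph_iff]
  constructor
  · rintro ⟨y, hy⟩
    exact ⟨y, y, rfl, hy⟩
  · rintro ⟨u, y, -, hy⟩
    exact ⟨y, hy⟩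

lemma mem_nul {T : H →ₗ.[ℂ] H} {u : H} : u ∈ nul T ↔ (u, (0 : H)) ∈ T.graph := by
  simp only [nul, Submodule.mem_map, LinearPMap.mem_graph_iff, LinearMap.mem_ker]
  constructor
  · rintro ⟨y, hy, rfl⟩
    exact ⟨y, rfl, hy⟩
  · rintro ⟨y, hy, h⟩
    exact ⟨y, h, hy⟩

lemma mem_ran_mulOp {B : H →L[ℂ] H} {D : H →ₗ.[ℂ] H} {w : H} :
    w ∈ ran (mulOp B D) ↔ ∃ v ∈ ran D, B v = w := by
  simp only [mem_ran, mem_graph_mulOp]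
  exact ⟨fun ⟨u, v, h, h'⟩ => ⟨v, ⟨u, h⟩, h'⟩, fun ⟨v, ⟨u, h⟩, h'⟩ => ⟨u, v, h, h'⟩⟩

lemma inner_graph_of_isSelfAdjoint {D : H →ₗ.[ℂ] H} (hD : IsSelfAdjoint D) {u v x y : H}
    (h : (u, v) ∈ D.graph) (h' : (x, y) ∈ D.graph) : inner ℂ v x = inner ℂ u y := by
  obtain ⟨a, rfl, rfl⟩ := (LinearPMap.mem_graph_iff _).1 h
  obtain ⟨b, rfl, rfl⟩ := (LinearPMap.mem_graph_iff _).1 h'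
  have := LinearPMap.adjoint_isFormalAdjoint hD.dense_domain
  rw [LinearPMap.isSelfAdjoint_def.1 hD] at this
  exact this a b

/-- The maximality half of self-adjointness: the hypothesis puts `u` in the domain of the adjoint,
which is `D` itself. -/
lemma mem_graph_of_inner_eq {D : H →ₗ.[ℂ] H} (hD : IsSelfAdjoint D) {u v : H}
    (h : ∀ x y, (x, y) ∈ D.graph → inner ℂ v x = inner ℂ u y) : (u, v) ∈ D.graph := by
  have h' : ∀ x : D.domain, inner ℂ v (x : H) = inner ℂ u (D x) :=
    fun x => h _ _ (LinearPMap.mem_graph D x)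
  have h1 := LinearPMap.mem_adjoint_domain_of_exists u ⟨v, h'⟩
  have h2 := LinearPMap.adjoint_apply_eq hD.dense_domain ⟨u, h1⟩ h'
  have h3 : (u, v) ∈ D.adjoint.graph := by
    have := LinearPMap.mem_graph (LinearPMap.adjoint D) ⟨u, h1⟩
    rwa [h2] at this
  rwa [LinearPMap.isSelfAdjoint_def.1 hD] at h3

lemma mem_graph_zero_of_mem_orthogonal {D : H →ₗ.[ℂ] H} (hD : IsSelfAdjoint D) {z : H}
    (hz : z ∈ (ran D)ᗮ) : (z, (0 : H)) ∈ D.graph := by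
  refine mem_graph_of_inner_eq hD fun x y h => ?_
  rw [inner_zero_left]
  exact ((Submodule.mem_orthogonal' _ _).1 hz y (mem_ran.2 ⟨x, h⟩)).symm

/-- Accretivity of `B` with constant `δ` on the closure of the range of `D`. -/
def AccretiveWith (δ : ℝ) (B : H →L[ℂ] H) (D : H →ₗ.[ℂ] H) : Prop :=
  ∀ v ∈ (ran D)ᗮᗮ, δ * ‖v‖ ^ 2 ≤ (inner ℂ (B v) v).re

lemma accretiveWith_of_forall {δ : ℝ} {B : H →L[ℂ] H} {D : H →ₗ.[ℂ] H}
    (h : ∀ u : D.domain, δ * ‖D u‖ ^ 2 ≤ (inner ℂ (B (D u)) (D u)).re) :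
    AccretiveWith δ B D := by
  intro v hv
  rw [Submodule.orthogonal_orthogonal_eq_closure] at hv
  have hc : IsClosed {v : H | δ * ‖v‖ ^ 2 ≤ (inner ℂ (B v) v).re} :=
    isClosed_le (by fun_prop) (by fun_prop)
  refine closure_minimal (s := (ran D : Set H)) ?_ hc hv
  rintro _ ⟨u, rfl⟩
  exact h u

lemma AccretiveWith.adjoint {δ : ℝ} {B : H →L[ℂ] H} {D : H →ₗ.[ℂ] H} (h : AccretiveWith δ B D) :
    AccretiveWith δ (ContinuousLinearMap.adjoint B) D := by
  intro v hv
  rw [ContinuousLinearMap.adjoint_inner_left, ← inner_conj_symm, Complex.conj_re]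
  exact h v hv

lemma AccretiveWith.le_norm {δ : ℝ} {B : H →L[ℂ] H} {D : H →ₗ.[ℂ] H} (h : AccretiveWith δ B D)
    {v : H} (hv : v ∈ (ran D)ᗮᗮ) : δ * ‖v‖ ≤ ‖B v‖ := by
  have h1 := h v hv
  have h2 : (inner ℂ (B v) v).re ≤ ‖B v‖ * ‖v‖ := re_inner_le_norm (𝕜 := ℂ) _ _
  rcases (norm_nonneg v).eq_or_lt with h0 | h0
  · rw [← h0]; simp
  · exact le_of_mul_le_mul_right (by nlinarith) h0

lemma ran_le_orthogonal_orthogonal {D : H →ₗ.[ℂ] H} {u v : H} (h : (u, v) ∈ D.graph) :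
    v ∈ (ran D)ᗮᗮ :=
  Submodule.le_orthogonal_orthogonal _ (mem_ran.2 ⟨u, h⟩)

/-! ### Resolvents on the imaginary axis -/

/-- `R s = (I + i s T)⁻¹` for real `s ≠ 0`, with norms bounded by `M`. -/
structure IsResolventFamily (T : H →ₗ.[ℂ] H) (R : ℝ → H →L[ℂ] H) (M : ℝ) : Prop where
  norm_le : ∀ s, s ≠ 0 → ‖R s‖ ≤ M
  exists_graph : ∀ s, s ≠ 0 → ∀ f, ∃ v, (R s f, v) ∈ T.graph ∧ R s f + (I * s) • v = f
  apply_graph : ∀ s, s ≠ 0 → ∀ u v, (u, v) ∈ T.graph → R s (u + (I * s) • v) = u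

section Resolvent

variable {D : H →ₗ.[ℂ] H} {B : H →L[ℂ] H} {δ : ℝ}

/-- Since `(u, Du)` is real, the imaginary part of `(u + isBDu, Du)` only sees the accretive term `s
Re (BDu, Du)`. -/
lemma norm_le_of_accretive (hD : IsSelfAdjoint D) (hB : AccretiveWith δ B D) {s : ℝ} {u v : H}
    (h : (u, v) ∈ D.graph) : |s| * δ * ‖v‖ ≤ ‖u + (I * s) • B v‖ := by
  have h1 := hB v (ran_le_orthogonal_orthogonal h)
  have h2 : (inner ℂ u v).im = 0 := by
    have := inner_graph_of_isSelfAdjoint hD h h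
    rw [← inner_conj_symm] at this
    exact Complex.conj_eq_iff_im.1 this
  have h3 : (inner ℂ (u + (I * s) • B v) v).im = - (s * (inner ℂ (B v) v).re) := by
    rw [inner_add_left, inner_smul_left]
    simp [h2]
  have h4 : |(inner ℂ (u + (I * s) • B v) v).im| ≤ ‖u + (I * s) • B v‖ * ‖v‖ :=
    (Complex.abs_im_le_norm _).trans (norm_inner_le_norm _ _)
  rw [h3, abs_neg, abs_mul] at h4
  have h5 : |s| * (δ * ‖v‖ ^ 2) ≤ ‖u + (I * s) • B v‖ * ‖v‖ :=
    (mul_le_mul_of_nonneg_left (h1.trans (le_abs_self _)) (abs_nonneg s)).trans h4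
  rcases (norm_nonneg v).eq_or_lt with h0 | h0
  · rw [← h0]; simp
  · exact le_of_mul_le_mul_right (by linarith) h0

/-- Orthogonality to the range of `I + isBD` forces `B*z` into the domain of `D` with `D B*z =
(is)⁻¹ z`. Hence `z` lies in the range of `D`, while `(B*z, D B*z)` real makes `(B*z, z)` purely
imaginary; accretivity of `B*` then kills `z`. -/
lemma eq_zero_of_forall_inner (hD : IsSelfAdjoint D) (hδ : 0 < δ) (hB : AccretiveWith δ B D)
    {s : ℝ} (hs : s ≠ 0) {z : H}
    (hz : ∀ u v, (u, v) ∈ D.graph → inner ℂ z (u + (I * s) • B v) = 0) : z = 0 := by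
  have hsI : (I * s : ℂ) ≠ 0 := by simpa using hs
  set w : H := ((I * s : ℂ)⁻¹) • z with hw
  have hg : (ContinuousLinearMap.adjoint B z, w) ∈ D.graph := by
    refine mem_graph_of_inner_eq hD fun u v h => ?_
    have := hz u v h
    rw [inner_add_right, inner_smul_right] at this
    rw [ContinuousLinearMap.adjoint_inner_left, hw, inner_smul_left]
    have h2 : inner ℂ z u = - ((I * s) * inner ℂ z (B v)) := by linear_combination this
    rw [h2]
    simp only [map_inv₀, map_mul, conj_I, conj_ofReal]
    have : (s : ℂ) ≠ 0 := by exact_mod_cast hs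
    have := I_ne_zero
    field_simp
  have hzw : z = (I * s : ℂ) • w := by rw [hw, smul_smul, mul_inv_cancel₀ hsI, one_smul]
  have hzr : z ∈ (ran D)ᗮᗮ := by
    rw [hzw]
    exact Submodule.smul_mem _ _ (ran_le_orthogonal_orthogonal hg)
  have h1 := hB.adjoint z hzr
  have h2 : (inner ℂ (ContinuousLinearMap.adjoint B z) w).im = 0 := by
    have := inner_graph_of_isSelfAdjoint hD hg hg
    rw [← inner_conj_symm] at this
    exact Complex.conj_eq_iff_im.1 this
  have h3 : (inner ℂ (ContinuousLinearMap.adjoint B z) z).re = 0 := by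
    nth_rewrite 2 [hzw]
    rw [inner_smul_right]
    simp [h2]
  rw [h3] at h1
  have : ‖z‖ ^ 2 ≤ 0 := by
    by_contra h
    push Not at h
    nlinarith [mul_pos hδ h]
  simpa using this

/-- `I + isBD` is bounded below on the graph of `D`, so its range is closed; the range is dense by
`eq_zero_of_forall_inner`. In `u = f - isBDu` the factor `|s|` cancels against the bound for `Du`,
which makes the resolvent bound uniform in `s`. -/
lemma exists_isResolventFamily (hD : IsSelfAdjoint D) (hδ : 0 < δ) (hB : AccretiveWith δ B D) :
    ∃ R, IsResolventFamily (mulOp B D) R (1 + ‖B‖ / δ) := by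
  have key : ∀ s : ℝ, s ≠ 0 → ∃ R : H →L[ℂ] H, ‖R‖ ≤ 1 + ‖B‖ / δ ∧
      (∀ f, ∃ v, (R f, v) ∈ D.graph ∧ R f + (I * s) • B v = f) ∧
      ∀ u v, (u, v) ∈ D.graph → R (u + (I * s) • B v) = u := by
    intro s hs
    have hs' : 0 < |s| := abs_pos.2 hs
    have : CompleteSpace D.graph := IsClosed.completeSpace_coe (hs := hD.isClosed)
    let L : D.graph →L[ℂ] H :=
      (ContinuousLinearMap.fst ℂ H H + (I * s : ℂ) • (B ∘L ContinuousLinearMap.snd ℂ H H)) ∘L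
        D.graph.subtypeL
    have hL : ∀ x : D.graph, L x = x.1.1 + (I * s : ℂ) • B x.1.2 := fun x => rfl
    have b2 : ∀ x : D.graph, ‖x.1.2‖ ≤ (|s| * δ)⁻¹ * ‖L x‖ := by
      intro x
      rw [← div_eq_inv_mul, le_div_iff₀ (by positivity), mul_comm, hL]
      exact norm_le_of_accretive hD hB x.2
    have b1 : ∀ x : D.graph, ‖x.1.1‖ ≤ (1 + ‖B‖ / δ) * ‖L x‖ := by
      intro x
      have e : x.1.1 = L x - (I * s : ℂ) • B x.1.2 := by rw [hL]; abel
      calc ‖x.1.1‖ = ‖L x - (I * s : ℂ) • B x.1.2‖ := by rw [← e]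
        _ ≤ ‖L x‖ + ‖(I * s : ℂ) • B x.1.2‖ := norm_sub_le _ _
        _ ≤ ‖L x‖ + |s| * (‖B‖ * ((|s| * δ)⁻¹ * ‖L x‖)) := by
            rw [norm_smul]
            simp only [norm_mul, norm_I, one_mul, norm_real, Real.norm_eq_abs]
            gcongr
            exact (B.le_opNorm _).trans (by gcongr; exact b2 x)
        _ = (1 + ‖B‖ / δ) * ‖L x‖ := by field_simp
    -- The lower bound in the graph norm may degenerate with `s`; it only serves to give closed
    -- range. The uniform bound kept for the resolvent is `b1`.
    set K : ℝ≥0 := Real.toNNReal (max (1 + ‖B‖ / δ) ((|s| * δ)⁻¹)) with hK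
    have anti : AntilipschitzWith K L := by
      refine ContinuousLinearMap.antilipschitz_of_bound L fun x => ?_
      rw [hK, Real.coe_toNNReal _ (by positivity)]
      refine (max_le ((b1 x).trans ?_) ((b2 x).trans ?_) : ‖x.1‖ ≤ _)
      · gcongr; exact le_max_left _ _
      · gcongr; exact le_max_right _ _
    have hker : (L : D.graph →ₗ[ℂ] H).ker = ⊥ := LinearMap.ker_eq_bot.2 anti.injective
    have hran : (L : D.graph →ₗ[ℂ] H).range = ⊤ := by
      have hcl : IsClosed ((L : D.graph →ₗ[ℂ] H).range : Set H) := by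
        rw [LinearMap.coe_range]
        exact anti.isClosed_range L.uniformContinuous
      rw [← hcl.submodule_topologicalClosure_eq, Submodule.topologicalClosure_eq_top_iff,
        Submodule.eq_bot_iff]
      intro z hz
      refine eq_zero_of_forall_inner hD hδ hB hs fun u v h => ?_
      exact (Submodule.mem_orthogonal' _ _).1 hz _ ⟨⟨(u, v), h⟩, rfl⟩
    let e := ContinuousLinearEquiv.ofBijective L hker hran
    have he : ∀ f, L (e.symm f) = f := fun f => e.apply_symm_apply f
    refine ⟨ContinuousLinearMap.fst ℂ H H ∘L D.graph.subtypeL ∘L (e.symm : H →L[ℂ] D.graph),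
      ?_, ?_, ?_⟩
    · refine ContinuousLinearMap.opNorm_le_bound _ (by positivity) fun f => ?_
      have := b1 (e.symm f)
      rwa [he] at this
    · intro f
      refine ⟨(e.symm f).1.2, (e.symm f).2, ?_⟩
      exact he f
    · intro u v h
      have : e.symm (u + (I * s : ℂ) • B v) = ⟨(u, v), h⟩ := by
        rw [ContinuousLinearEquiv.symm_apply_eq]; rfl
      simp [this]
  choose! R hR using key
  refine ⟨R, fun s hs => (hR s hs).1, fun s hs f => ?_, fun s hs u w h => ?_⟩
  · obtain ⟨v, hv, h⟩ := (hR s hs).2.1 f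
    exact ⟨B v, mem_graph_mulOp.2 ⟨v, hv, rfl⟩, h⟩
  · obtain ⟨v, hv, rfl⟩ := mem_graph_mulOp.1 h
    exact (hR s hs).2.2 u v hv

end Resolvent

/-! ### Consequences of the resolvent bounds -/

/-- `sT (I + s² T²)⁻¹` in terms of the resolvents `R s = (I + i s T)⁻¹`. -/
noncomputable def resQ (R : ℝ → H →L[ℂ] H) (s : ℝ) : H →L[ℂ] H := (2 * I : ℂ)⁻¹ • (R (-s) - R s)

lemma qOp_eq_of_isQ {T : H →ₗ.[ℂ] H} {s : ℝ} {Q : H →L[ℂ] H} (hQ : IsQ T s Q) :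
    qOp T s = Q := by
  have h : ∃ Q : H →L[ℂ] H, IsQ T s Q := ⟨Q, hQ⟩
  rw [qOp, dif_pos h]
  ext u
  obtain ⟨w, ⟨h1, h2, rfl⟩, -⟩ := hQ.1 u
  rw [h.choose_spec.2 w h1 h2, hQ.2 w h1 h2]

namespace IsResolventFamily

variable {T : H →ₗ.[ℂ] H} {R : ℝ → H →L[ℂ] H} {M : ℝ}

lemma nonneg (h : IsResolventFamily T R M) : 0 ≤ M := (norm_nonneg _).trans (h.norm_le 1 one_ne_zero)

lemma norm_apply_le (h : IsResolventFamily T R M) {s : ℝ} (hs : s ≠ 0) (f : H) :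
    ‖R s f‖ ≤ M * ‖f‖ := (R s).le_of_opNorm_le (h.norm_le s hs) f

lemma mem_graph (h : IsResolventFamily T R M) {s : ℝ} (hs : s ≠ 0) (f : H) :
    (R s f, ((I * s : ℂ)⁻¹) • (f - R s f)) ∈ T.graph := by
  obtain ⟨v, hv, e⟩ := h.exists_graph s hs f
  have hsI : (I * s : ℂ) ≠ 0 := by simpa using hs
  have : ((I * s : ℂ)⁻¹) • (f - R s f) = v := by
    rw [inv_smul_eq_iff₀ hsI]
    exact (eq_sub_of_add_eq' e).symm
  rwa [this]

lemma apply_of_mem_graph (h : IsResolventFamily T R M) {s : ℝ} (hs : s ≠ 0) {u v : H}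
    (huv : (u, v) ∈ T.graph) : R s u = u - (I * s : ℂ) • R s v := by
  have := h.apply_graph s hs u v huv
  rw [map_add, map_smul] at this
  exact eq_sub_of_add_eq this

lemma apply_mem_graph (h : IsResolventFamily T R M) {s : ℝ} (hs : s ≠ 0) {u v : H}
    (huv : (u, v) ∈ T.graph) : (R s u, R s v) ∈ T.graph := by
  have := h.mem_graph hs u
  have hsI : (I * s : ℂ) ≠ 0 := by simpa using hs
  rwa [show u - R s u = (I * s : ℂ) • R s v by rw [h.apply_of_mem_graph hs huv]; abel,
    inv_smul_smul₀ hsI] at this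

/-- The resolvent identity. -/
lemma resolvent_identity (h : IsResolventFamily T R M) {s t : ℝ} (hs : s ≠ 0) (ht : t ≠ 0) :
    s • R s - t • R t = (s - t) • (R s * R t) := by
  ext f
  have h1 := h.apply_of_mem_graph hs (h.mem_graph ht f)
  have ht' : (t : ℂ) ≠ 0 := by exact_mod_cast ht
  have h2 : (t : ℂ) • R s (R t f) = (t : ℂ) • R t f - (s : ℂ) • (R s f - R s (R t f)) := by
    refine (congrArg ((t : ℂ) • ·) h1).trans ?_
    simp only [map_smul, map_sub, smul_sub, smul_smul]
    congr 3 <;> field_simp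
  simp only [_root_.sub_apply, _root_.smul_apply,
    _root_.mul_apply_eq_comp, sub_smul]
  rw [← Complex.coe_smul, ← Complex.coe_smul, ← Complex.coe_smul, ← Complex.coe_smul, h2]
  module

lemma commute (h : IsResolventFamily T R M) {s t : ℝ} (hs : s ≠ 0) (ht : t ≠ 0) :
    Commute (R s) (R t) := by
  rcases eq_or_ne s t with rfl | hst
  · exact Commute.refl _
  · have h1 := h.resolvent_identity hs ht
    have h2 := h.resolvent_identity ht hs
    have h3 : (s - t) • (R s * R t) = (s - t) • (R t * R s) := by
      rw [← h1, ← neg_sub t s, neg_smul, ← h2]; abel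
    exact smul_right_injective _ (sub_ne_zero.2 hst) h3

lemma add_neg_eq (h : IsResolventFamily T R M) {s : ℝ} (hs : s ≠ 0) :
    R s + R (-s) = (2 : ℝ) • (R s * R (-s)) := by
  have h1 := h.resolvent_identity hs (neg_ne_zero.2 hs)
  have : s • (R s + R (-s)) = s • ((2 : ℝ) • (R s * R (-s))) := by
    rw [smul_smul, show s * 2 = s - -s by ring, ← h1]
    module
  exact smul_right_injective _ hs this

/-- By the resolvent identity the difference quotient of `t ↦ t R t` at `s` is exactly `R t * R s`.
The same identity with the uniform bound gives continuity of `R` in norm, so `t R t` has derivative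
`R s * R s`, and dividing by `t` finishes. -/
lemma hasDerivAt (h : IsResolventFamily T R M) {s : ℝ} (hs : s ≠ 0) :
    HasDerivAt R (s⁻¹ • (R s * R s - R s)) s := by
  have hne : ∀ᶠ t in 𝓝 s, t ≠ 0 := eventually_ne_nhds hs
  have hlip : ∀ t, t ≠ 0 → ‖t • R t - s • R s‖ ≤ |t - s| * (M * M) := by
    intro t ht
    rw [h.resolvent_identity ht hs, norm_smul]
    refine mul_le_mul_of_nonneg_left ((norm_mul_le _ _).trans ?_) (norm_nonneg _)
    have := h.nonneg
    gcongr
    exacts [h.norm_le t ht, h.norm_le s hs]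
  have hcont1 : Tendsto (fun t => t • R t) (𝓝 s) (𝓝 (s • R s)) := by
    rw [tendsto_iff_norm_sub_tendsto_zero]
    refine squeeze_zero' (Eventually.of_forall fun _ => norm_nonneg _) (hne.mono hlip) ?_
    have : Tendsto (fun t : ℝ => |t - s| * (M * M)) (𝓝 s) (𝓝 (|s - s| * (M * M))) :=
      Continuous.tendsto (by fun_prop) s
    simpa using this
  have hcont : Tendsto R (𝓝 s) (𝓝 (R s)) := by
    have := (tendsto_inv₀ hs).smul hcont1
    rw [inv_smul_smul₀ hs] at this
    refine this.congr' (hne.mono fun t ht => ?_)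
    simp [inv_smul_smul₀ ht]
  have hd : HasDerivAt (fun t => t • R t) (R s * R s) s := by
    rw [hasDerivAt_iff_tendsto_slope]
    have : Tendsto (fun t => R t * R s) (𝓝[≠] s) (𝓝 (R s * R s)) :=
      (hcont.mul_const _).mono_left nhdsWithin_le_nhds
    refine this.congr' ?_
    filter_upwards [nhdsWithin_le_nhds hne, self_mem_nhdsWithin] with t ht hts
    rw [slope_def_module, h.resolvent_identity ht hs, inv_smul_smul₀ (sub_ne_zero.2 hts)]
  have h2 := (hasDerivAt_inv hs).smul hd
  have h3 : HasDerivAt R ((s⁻¹) • (R s * R s) + (-(s ^ 2)⁻¹) • (s • R s)) s := by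
    refine h2.congr_of_eventuallyEq (hne.mono fun t ht => ?_)
    simp [inv_smul_smul₀ ht]
  convert h3 using 1
  rw [smul_sub, smul_smul, sub_eq_add_neg, ← neg_smul]
  congr 2
  field_simp

/-- The factorisation `I + s²T² = (I - isT)(I + isT)`, whose inverse is `R s (R (-s))`, combined
with partial fractions. -/
lemma isQ (h : IsResolventFamily T R M) {s : ℝ} (hs : s ≠ 0) : IsQ T s (resQ R s) := by
  have hs0 : (s : ℂ) ≠ 0 := by exact_mod_cast hs
  have hsI : (I * s : ℂ) ≠ 0 := by simpa using hs
  have hn : -s ≠ 0 := neg_ne_zero.2 hs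
  have key : ∀ (w : H) (h1 : w ∈ T.domain) (h2 : T ⟨w, h1⟩ ∈ T.domain),
      R (-s) (w + (s : ℂ) ^ 2 • T ⟨T ⟨w, h1⟩, h2⟩) = w + (I * s : ℂ) • T ⟨w, h1⟩ ∧
      R s (w + (s : ℂ) ^ 2 • T ⟨T ⟨w, h1⟩, h2⟩) = w - (I * s : ℂ) • T ⟨w, h1⟩ := by
    intro w h1 h2
    have g1 : (w, T ⟨w, h1⟩) ∈ T.graph := LinearPMap.mem_graph T ⟨w, h1⟩
    have g2 : (T ⟨w, h1⟩, T ⟨T ⟨w, h1⟩, h2⟩) ∈ T.graph :=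
      LinearPMap.mem_graph T ⟨T ⟨w, h1⟩, h2⟩
    have I2 := I_mul_I
    constructor
    · have g3 : (w + (I * s : ℂ) • T ⟨w, h1⟩, T ⟨w, h1⟩ + (I * s : ℂ) • T ⟨T ⟨w, h1⟩, h2⟩) ∈
          T.graph := T.graph.add_mem g1 (T.graph.smul_mem (I * s : ℂ) g2)
      rw [← h.apply_graph (-s) hn _ _ g3]
      congr 1
      push_cast
      simp only [smul_add, smul_smul]
      rw [show (I * -(s : ℂ) * (I * s)) = (s : ℂ) ^ 2 by linear_combination -(s : ℂ) ^ 2 * I2]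
      module
    · have g3 : (w - (I * s : ℂ) • T ⟨w, h1⟩, T ⟨w, h1⟩ - (I * s : ℂ) • T ⟨T ⟨w, h1⟩, h2⟩) ∈
          T.graph := T.graph.sub_mem g1 (T.graph.smul_mem (I * s : ℂ) g2)
      rw [← h.apply_graph s hs _ _ g3]
      congr 1
      simp only [smul_sub, smul_smul]
      rw [show (I * (s : ℂ) * (I * s)) = -(s : ℂ) ^ 2 by linear_combination (s : ℂ) ^ 2 * I2]
      module
  refine ⟨fun u => ?_, fun w h1 h2 => ?_⟩
  · refine ⟨R s (R (-s) u), ?_, ?_⟩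
    · generalize hv : R (-s) u = v
      generalize hw : R s v = w
      have gv := h.mem_graph hn u
      have gw := h.mem_graph hs v
      rw [hv] at gv
      rw [hw] at gw
      clear hv hw
      have g2 := T.graph.smul_mem ((I * s : ℂ)⁻¹) (T.graph.sub_mem gv gw)
      obtain ⟨y, hy1, hy2⟩ := (LinearPMap.mem_graph_iff _).1 gw
      obtain ⟨z, hz1, hz2⟩ := (LinearPMap.mem_graph_iff _).1 g2
      obtain ⟨y, hy⟩ := y
      obtain ⟨z, hz⟩ := z
      simp only at hy1 hy2 hz1 hz2
      subst hy1
      have e1 : z = T ⟨y, hy⟩ := by rw [hy2, hz1]; rfl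
      subst e1
      refine ⟨hy, hz, ?_⟩
      rw [hz2]
      change y + (s : ℂ) ^ 2 • (I * s : ℂ)⁻¹ •
        ((I * (-s : ℝ) : ℂ)⁻¹ • (u - v) - (I * s : ℂ)⁻¹ • (v - y)) = u
      simp only [smul_sub, smul_smul]
      push_cast
      have I2 := I_sq
      have e1 : (s : ℂ) ^ 2 * ((I * s)⁻¹ * (I * -s)⁻¹) = 1 := by
        field_simp
        rw [I2]
      have e2 : (s : ℂ) ^ 2 * ((I * s)⁻¹ * (I * s)⁻¹) = -1 := by
        field_simp
        rw [I2]; norm_num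
      rw [e1, e2]
      module
    · rintro w ⟨h1, h2, rfl⟩
      rw [(key w h1 h2).1]
      exact (h.apply_graph s hs _ _ (LinearPMap.mem_graph T ⟨w, h1⟩)).symm
  · rw [resQ, _root_.smul_apply, _root_.sub_apply, (key w h1 h2).1,
      (key w h1 h2).2, inv_smul_eq_iff₀ (by simp), smul_smul]
    module

lemma qOp_eq (h : IsResolventFamily T R M) {s : ℝ} (hs : s ≠ 0) : qOp T s = resQ R s :=
  qOp_eq_of_isQ (h.isQ hs)

lemma resQ_mem_ran (h : IsResolventFamily T R M) {s : ℝ} (hs : s ≠ 0) (f : H) :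
    resQ R s f ∈ ran T := by
  have hn : -s ≠ 0 := neg_ne_zero.2 hs
  have hsI : (I * s : ℂ) ≠ 0 := by simpa using hs
  have hnI : (I * (-s : ℝ) : ℂ) ≠ 0 := by simpa using hs
  have aux : ∀ r : ℝ, r ≠ 0 → f - R r f ∈ ran T := by
    intro r hr
    have hrI : (I * r : ℂ) ≠ 0 := by simpa using hr
    have := Submodule.smul_mem _ (I * r : ℂ) (mem_ran.2 ⟨_, h.mem_graph hr f⟩)
    rwa [smul_inv_smul₀ hrI] at this
  rw [resQ, _root_.smul_apply, _root_.sub_apply]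
  refine Submodule.smul_mem _ _ ?_
  have := Submodule.sub_mem _ (aux s hs) (aux (-s) hn)
  rwa [sub_sub_sub_cancel_left] at this

lemma norm_resQ_le (h : IsResolventFamily T R M) {s : ℝ} (hs : s ≠ 0) : ‖resQ R s‖ ≤ M := by
  have h1 := norm_sub_le (R (-s)) (R s)
  have h2 := h.norm_le s hs
  have h3 := h.norm_le (-s) (neg_ne_zero.2 hs)
  rw [resQ, norm_smul]
  simp only [norm_inv, norm_mul, norm_I, Complex.norm_ofNat]
  linarith

lemma apply_of_mem_nul (h : IsResolventFamily T R M) {s : ℝ} (hs : s ≠ 0) {z : H}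
    (hz : (z, (0 : H)) ∈ T.graph) : R s z = z := by
  simpa using h.apply_of_mem_graph hs hz

lemma resQ_apply_of_mem_nul (h : IsResolventFamily T R M) {s : ℝ} (hs : s ≠ 0) {z : H}
    (hz : (z, (0 : H)) ∈ T.graph) : resQ R s z = 0 := by
  simp [resQ, h.apply_of_mem_nul hs hz, h.apply_of_mem_nul (neg_ne_zero.2 hs) hz]

lemma norm_apply_sub_le (h : IsResolventFamily T R M) {s : ℝ} (hs : s ≠ 0) {u v : H}
    (huv : (u, v) ∈ T.graph) : ‖R s u - u‖ ≤ |s| * (M * ‖v‖) := by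
  rw [h.apply_of_mem_graph hs huv, sub_sub_cancel_left, norm_neg, norm_smul]
  simp only [norm_mul, norm_I, one_mul, norm_real, Real.norm_eq_abs]
  exact mul_le_mul_of_nonneg_left (h.norm_apply_le hs v) (abs_nonneg s)

lemma norm_apply_ran_le (h : IsResolventFamily T R M) {s : ℝ} (hs : s ≠ 0) {u v : H}
    (huv : (u, v) ∈ T.graph) : ‖R s v‖ ≤ |s|⁻¹ * ((1 + M) * ‖u‖) := by
  have h1 := h.apply_of_mem_graph hs huv
  have h2 : ‖(I * s : ℂ) • R s v‖ ≤ (1 + M) * ‖u‖ := by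
    rw [show (I * s : ℂ) • R s v = u - R s u by rw [h1]; abel, add_mul, one_mul]
    exact (norm_sub_le _ _).trans (by gcongr; exact h.norm_apply_le hs u)
  rw [norm_smul] at h2
  simp only [norm_mul, norm_I, one_mul, norm_real, Real.norm_eq_abs] at h2
  rwa [← div_eq_inv_mul, le_div_iff₀ (abs_pos.2 hs), mul_comm]

/-- Decay at small `s`, on the domain of `T`; `norm_resQ_ran_le` is its counterpart at large `s`, on
the range. Together they give absolute convergence of the integral. -/
lemma norm_resQ_apply_le (h : IsResolventFamily T R M) {s : ℝ} (hs : s ≠ 0) {u v : H}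
    (huv : (u, v) ∈ T.graph) : ‖resQ R s u‖ ≤ |s| * (M * ‖v‖) := by
  have h1 := h.norm_apply_sub_le hs huv
  have h2 := h.norm_apply_sub_le (neg_ne_zero.2 hs) huv
  have h3 := norm_sub_le (R (-s) u - u) (R s u - u)
  rw [sub_sub_sub_cancel_right] at h3
  rw [resQ, _root_.smul_apply, norm_smul]
  rw [abs_neg] at h2
  simp only [norm_inv, norm_mul, norm_I, Complex.norm_ofNat, _root_.sub_apply]
  linarith

lemma norm_resQ_ran_le (h : IsResolventFamily T R M) {s : ℝ} (hs : s ≠ 0) {u v : H}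
    (huv : (u, v) ∈ T.graph) : ‖resQ R s v‖ ≤ |s|⁻¹ * ((1 + M) * ‖u‖) := by
  have h1 := h.norm_apply_ran_le hs huv
  have h2 := h.norm_apply_ran_le (neg_ne_zero.2 hs) huv
  have h3 := norm_sub_le (R (-s) v) (R s v)
  rw [resQ, _root_.smul_apply, norm_smul]
  rw [abs_neg] at h2
  simp only [norm_inv, norm_mul, norm_I, Complex.norm_ofNat, _root_.sub_apply]
  linarith

end IsResolventFamily

/-! ### Strong convergence -/

lemma tendsto_apply_of_mem_closure {ι : Type*} {l : Filter ι} {A : ι → H →L[ℂ] H}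
    {A₀ : H →L[ℂ] H} {K : ℝ} (hK : ∀ᶠ i in l, ‖A i‖ ≤ K) {S : Set H}
    (hS : ∀ x ∈ S, Tendsto (fun i => A i x) l (𝓝 (A₀ x))) {x : H} (hx : x ∈ closure S) :
    Tendsto (fun i => A i x) l (𝓝 (A₀ x)) := by
  rcases l.eq_or_neBot with rfl | hl
  · exact tendsto_bot
  have hK0 : 0 ≤ K := by
    obtain ⟨i, hi⟩ := hK.exists
    exact (norm_nonneg _).trans hi
  rw [Metric.tendsto_nhds]
  intro ε hε
  set L := K + ‖A₀‖ + 1 with hL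
  have hL0 : 0 < L := by positivity
  obtain ⟨y, hy, hxy⟩ := Metric.mem_closure_iff.1 hx (ε / 2 / L) (by positivity)
  filter_upwards [hK, Metric.tendsto_nhds.1 (hS y hy) (ε / 2) (by positivity)] with i hi hi2
  rw [dist_eq_norm] at hxy hi2 ⊢
  have e : A i x - A₀ x = A i (x - y) - A₀ (x - y) + (A i y - A₀ y) := by
    simp only [map_sub]; abel
  rw [lt_div_iff₀ hL0] at hxy
  have h1 := (A i).le_of_opNorm_le hi (x - y)
  have h2 := A₀.le_opNorm (x - y)
  have h3 := norm_sub_le (A i (x - y)) (A₀ (x - y))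
  have h4 := norm_add_le (A i (x - y) - A₀ (x - y)) (A i y - A₀ y)
  rw [e]
  have h5 : 0 ≤ ‖x - y‖ := norm_nonneg _
  have h6 : K * ‖x - y‖ + ‖A₀‖ * ‖x - y‖ + ‖x - y‖ < ε / 2 := by rw [hL] at hxy; linarith
  linarith

namespace IsResolventFamily

variable {T : H →ₗ.[ℂ] H} {R : ℝ → H →L[ℂ] H} {M : ℝ}

lemma tendsto_zero (h : IsResolventFamily T R M) (hT : Dense (T.domain : Set H)) {ι : Type*}
    {l : Filter ι} {r : ι → ℝ} (hr : ∀ᶠ i in l, r i ≠ 0) (hr0 : Tendsto r l (𝓝 0)) (x : H) :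
    Tendsto (fun i => R (r i) x) l (𝓝 x) := by
  refine tendsto_apply_of_mem_closure (A₀ := ContinuousLinearMap.id ℂ H)
    (hr.mono fun i hi => h.norm_le _ hi) (fun u hu => ?_) (hT x)
  rw [tendsto_iff_norm_sub_tendsto_zero]
  have hg := LinearPMap.mem_graph T ⟨u, hu⟩
  refine squeeze_zero' (Eventually.of_forall fun _ => norm_nonneg _)
    (hr.mono fun i hi => h.norm_apply_sub_le hi hg) ?_
  simpa using (hr0.abs).mul_const (M * ‖T ⟨u, hu⟩‖)

lemma tendsto_atTop (h : IsResolventFamily T R M) {ι : Type*} {l : Filter ι} {r : ι → ℝ}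
    (hr : ∀ᶠ i in l, r i ≠ 0) (hr0 : Tendsto (fun i => |r i|) l atTop) {y : H}
    (hy : y ∈ (ran T).topologicalClosure) : Tendsto (fun i => R (r i) y) l (𝓝 0) := by
  refine tendsto_apply_of_mem_closure (A₀ := (0 : H →L[ℂ] H)) (S := (ran T : Set H))
    (hr.mono fun i hi => h.norm_le _ hi) (fun v hv => ?_) hy
  obtain ⟨u, hg⟩ := mem_ran.1 hv
  refine squeeze_zero_norm' (hr.mono fun i hi => h.norm_apply_ran_le hi hg) ?_
  simpa using (tendsto_inv_atTop_zero.comp hr0).mul_const ((1 + M) * ‖u‖)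

end IsResolventFamily

/-! ### Density of `N(BD) + (D(BD) ∩ R(BD))` and adjoints of the resolvents -/

section Perturbation

variable {D : H →ₗ.[ℂ] H} {B : H →L[ℂ] H} {δ : ℝ} {R R' : ℝ → H →L[ℂ] H} {M M' : ℝ}

/-- For `w` in `R(BD)`, `R s w` lies in `D(BD) ∩ R(BD)` and tends to `w` as `s → 0`, so a vector `z`
orthogonal to the sum is orthogonal to `R(BD)`. It is also orthogonal to the null space, which
contains `R(D)ᗮ`, so `z` is in the closure of `R(D)`. By continuity `(z, Bz) = 0`, and accretivity
gives `z = 0`. -/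
lemma dense_nul_sup (hD : IsSelfAdjoint D) (hδ : 0 < δ) (hB : AccretiveWith δ B D)
    (h : IsResolventFamily (mulOp B D) R M) :
    Dense ((nul (mulOp B D) ⊔ ((mulOp B D).domain ⊓ ran (mulOp B D)) : Submodule ℂ H) : Set H) := by
  have hT : Dense ((mulOp B D).domain : Set H) := hD.dense_domain
  rw [Submodule.dense_iff_topologicalClosure_eq_top, Submodule.topologicalClosure_eq_top_iff,
    Submodule.eq_bot_iff]
  intro z hz
  rw [Submodule.mem_orthogonal'] at hz
  have hran : ∀ v ∈ ran D, inner ℂ z (B v) = 0 := by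
    intro v hv
    obtain ⟨u, hu⟩ := mem_ran.1 (mem_ran_mulOp.2 ⟨v, hv, rfl⟩ : B v ∈ ran (mulOp B D))
    have hne : ∀ᶠ s : ℝ in 𝓝[≠] 0, s ≠ 0 := self_mem_nhdsWithin
    have h1 := (innerSL ℂ z).continuous.tendsto _ |>.comp
      (h.tendsto_zero hT hne (tendsto_id.mono_left nhdsWithin_le_nhds) (B v))
    refine tendsto_nhds_unique h1 (tendsto_const_nhds.congr' (hne.mono fun s hs => ?_))
    refine (hz _ (Submodule.mem_sup_right ⟨?_, mem_ran.2 ⟨_, h.apply_mem_graph hs hu⟩⟩)).symm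
    obtain ⟨y, hy, -⟩ := (LinearPMap.mem_graph_iff _).1 (h.mem_graph hs (B v))
    simp only at hy
    rw [← hy]
    exact y.2
  have hzr : z ∈ (ran D)ᗮᗮ := by
    rw [Submodule.mem_orthogonal']
    intro n hn
    refine hz n (Submodule.mem_sup_left (mem_nul.2 (mem_graph_mulOp.2 ⟨0, ?_, map_zero B⟩)))
    exact mem_graph_zero_of_mem_orthogonal hD hn
  have hzz : inner ℂ z (B z) = 0 := by
    have hc : IsClosed {v : H | inner ℂ z (B v) = 0} := isClosed_eq (by fun_prop) (by fun_prop)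
    rw [Submodule.orthogonal_orthogonal_eq_closure] at hzr
    exact closure_minimal (s := (ran D : Set H)) hran hc hzr
  have h1 := hB z hzr
  rw [← inner_conj_symm, hzz, map_zero, Complex.zero_re] at h1
  have : ‖z‖ ^ 2 ≤ 0 := by
    by_contra h
    push Not at h
    nlinarith [mul_pos hδ h]
  simpa using this

/-- Formally, `B* (I - isDB*)⁻¹ = (I - isB*D)⁻¹ B*`. -/
lemma adjoint_comp_resolvent (hD : IsSelfAdjoint D) (h : IsResolventFamily (mulOp B D) R M)
    (h' : IsResolventFamily (mulOp (adjoint B) D) R' M') {s : ℝ} (hs : s ≠ 0) (f : H) :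
    adjoint B (adjoint (R s) f) = R' (-s) (adjoint B f) := by
  set v := adjoint (R s) f with hv
  have hsI : (I * s : ℂ) ≠ 0 := by simpa using hs
  have hnI : (I * (-s : ℝ) : ℂ) ≠ 0 := by simpa using hs
  have hg : (adjoint B v, ((I * (-s : ℝ) : ℂ)⁻¹) • (f - v)) ∈ D.graph := by
    refine mem_graph_of_inner_eq hD fun x y hxy => ?_
    have h1 := h.apply_graph s hs x (B y) (mem_graph_mulOp.2 ⟨y, hxy, rfl⟩)
    have h2 : inner ℂ v (x + (I * s : ℂ) • B y) = inner ℂ f x := by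
      rw [hv, adjoint_inner_left, h1]
    rw [inner_add_right, inner_smul_right] at h2
    rw [adjoint_inner_left, inner_smul_left, inner_sub_left, ← h2]
    simp only [map_inv₀, map_mul, conj_I, conj_ofReal]
    have : (s : ℂ) ≠ 0 := by exact_mod_cast hs
    have := I_ne_zero
    push_cast
    field_simp
    ring
  have h3 := h'.apply_graph (-s) (neg_ne_zero.2 hs) _ _ (mem_graph_mulOp.2 ⟨_, hg, rfl⟩)
  rw [map_smul, smul_inv_smul₀ hnI, map_sub, add_sub_cancel] at h3
  exact h3.symm

lemma adjoint_comp_resQ (hD : IsSelfAdjoint D) (h : IsResolventFamily (mulOp B D) R M)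
    (h' : IsResolventFamily (mulOp (adjoint B) D) R' M') {s : ℝ} (hs : s ≠ 0) (f : H) :
    adjoint B (adjoint (resQ R s) f) = resQ R' s (adjoint B f) := by
  have h1 := adjoint_comp_resolvent hD h h' hs f
  have h2 := adjoint_comp_resolvent hD h h' (neg_ne_zero.2 hs) f
  rw [neg_neg] at h2
  have e : adjoint (resQ R s) = (2 * I : ℂ)⁻¹ • (adjoint (R s) - adjoint (R (-s))) := by
    rw [resQ, map_smulₛₗ, map_sub]
    simp only [map_inv₀, map_mul, conj_I, Complex.conj_ofNat]
    rw [mul_neg, inv_neg, neg_smul, ← smul_neg, neg_sub]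
  rw [e, resQ]
  simp only [_root_.smul_apply, _root_.sub_apply, map_smul, map_sub, h1, h2]

/-- `resQ R s` vanishes on `R(D)ᗮ`, so its adjoint takes values in the closure of `R(D)`, where `B*`
is bounded below by `δ`. -/
lemma norm_adjoint_resQ_le (hD : IsSelfAdjoint D) (hδ : 0 < δ) (hB : AccretiveWith δ B D)
    (h : IsResolventFamily (mulOp B D) R M)
    (h' : IsResolventFamily (mulOp (adjoint B) D) R' M') {s : ℝ} (hs : s ≠ 0) (f : H) :
    ‖adjoint (resQ R s) f‖ ≤ δ⁻¹ * ‖resQ R' s (adjoint B f)‖ := by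
  rw [← div_eq_inv_mul, le_div_iff₀ hδ, mul_comm, ← adjoint_comp_resQ hD h h' hs]
  refine hB.adjoint.le_norm ((Submodule.mem_orthogonal' _ _).2 fun z hz => ?_)
  rw [adjoint_inner_left, h.resQ_apply_of_mem_nul hs, inner_zero_right]
  exact mem_graph_mulOp.2 ⟨0, mem_graph_zero_of_mem_orthogonal hD hz, map_zero B⟩

end Perturbation

end

/-! ### Calculus in a Banach algebra -/

section BanachAlgebra

variable {𝔸 : Type*} [NormedRing 𝔸] [NormedAlgebra ℂ 𝔸] [CompleteSpace 𝔸]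

/-- Commutation allows `exp (X r) = exp (X t) * exp (X r - X t)`, so only the derivative of `exp` at
`0` is needed. -/
lemma hasDerivAt_exp_of_commute {X : ℝ → 𝔸} {X' : 𝔸} {t : ℝ} (hX : HasDerivAt X X' t)
    (hc : ∀ᶠ r in 𝓝 t, Commute (X t) (X r)) :
    HasDerivAt (fun r => NormedSpace.exp (X r)) (NormedSpace.exp (X t) * X') t := by
  let _ : NormedAlgebra ℚ 𝔸 := NormedAlgebra.restrictScalars ℚ ℂ 𝔸
  have h1 : HasDerivAt (fun r => X r - X t) X' t := hX.sub_const _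
  have h0 : HasFDerivAt (NormedSpace.exp : 𝔸 → 𝔸) (1 : 𝔸 →L[ℝ] 𝔸) (X t - X t) := by
    rw [sub_self]
    exact hasFDerivAt_exp_zero
  have h2 : HasDerivAt (fun r => NormedSpace.exp (X r - X t)) X' t := by
    exact h0.comp_hasDerivAt t h1
  have h3 := h2.const_mul (NormedSpace.exp (X t))
  refine h3.congr_of_eventuallyEq (hc.mono fun r hr => ?_)
  change NormedSpace.exp (X r) = NormedSpace.exp (X t) * NormedSpace.exp (X r - X t)
  rw [← NormedSpace.exp_add_of_commute (hr.sub_right (Commute.refl _)), add_sub_cancel]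

lemma commute_intervalIntegral {g : ℝ → 𝔸} {x : 𝔸} {a b : ℝ} (hg : IntervalIntegrable g volume a b)
    (hc : ∀ t ∈ uIcc a b, Commute x (g t)) : Commute x (∫ t in a..b, g t) := by
  have h1 := (ContinuousLinearMap.mul ℝ 𝔸 x).intervalIntegral_comp_comm hg
  have h2 := ((ContinuousLinearMap.mul ℝ 𝔸).flip x).intervalIntegral_comp_comm hg
  simp only [ContinuousLinearMap.flip_apply, ContinuousLinearMap.mul_apply'] at h1 h2
  rw [Commute, SemiconjBy, ← h1, ← h2]
  exact intervalIntegral.integral_congr hc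

/-- A pair of commuting families behaving like `p = (1 + s² z²)⁻¹` and `q = s z (1 + s² z²)⁻¹`
for `s = t ^ κ`, as functions of `t > 0`. -/
structure IsCauchyPair (κ : ℝ) (p q : ℝ → 𝔸) : Prop where
  hasDerivAt_p : ∀ t, 0 < t → HasDerivAt p ((κ / t) • ((2 : ℝ) • (p t * p t - p t))) t
  hasDerivAt_q : ∀ t, 0 < t → HasDerivAt q ((κ / t) • (q t * ((2 : ℝ) • p t - 1))) t
  mul_self : ∀ t, 0 < t → q t * q t = p t - p t * p t
  comm : ∀ t, 0 < t → q t * p t = p t * q t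
  commute : ∀ s t, 0 < s → 0 < t → Commute (q s) (q t)

namespace IsCauchyPair

variable {κ : ℝ} {p q : ℝ → 𝔸}

lemma continuousOn_q (h : IsCauchyPair κ p q) : ContinuousOn q (Ioi 0) :=
  fun t ht => (h.hasDerivAt_q t ht).continuousAt.continuousWithinAt

lemma continuousOn_inv_smul (h : IsCauchyPair κ p q) :
    ContinuousOn (fun t : ℝ => t⁻¹ • q t) (Ioi 0) :=
  (continuousOn_inv₀.mono fun _ ht => ne_of_gt ht).smul h.continuousOn_q

lemma continuousOn_inv_smul_pow (h : IsCauchyPair κ p q) :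
    ContinuousOn (fun t : ℝ => t⁻¹ • q t ^ 3) (Ioi 0) :=
  (continuousOn_inv₀.mono fun _ ht => ne_of_gt ht).smul (h.continuousOn_q.pow 3)

/-- `q² = p - p²` gives `q³ = pq - p²q`, so a suitable combination of `q` and `pq` is a primitive of
`q³ dt/t` modulo a multiple of `q dt/t`. -/
lemma hasDerivAt_boundary (h : IsCauchyPair κ p q) {t : ℝ} (ht : 0 < t) :
    HasDerivAt (fun t => (2 : ℝ) • q t - (4 : ℝ) • (p t * q t))
      ((κ / t) • ((16 : ℝ) • q t ^ 3 - (2 : ℝ) • q t)) t := by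
  have h1 := ((h.hasDerivAt_q t ht).const_smul (2 : ℝ)).sub
    (((h.hasDerivAt_p t ht).mul (h.hasDerivAt_q t ht)).const_smul (4 : ℝ))
  refine h1.congr_deriv ?_
  have hc := h.comm t ht
  have e : q t ^ 3 = p t * q t - p t * (p t * q t) := by
    rw [pow_succ, sq, h.mul_self t ht, sub_mul, mul_assoc]
  rw [e]
  simp only [mul_sub, sub_mul, smul_mul_assoc, mul_smul_comm, mul_assoc, hc, mul_one]
  module

/-- In scalar terms `2(p + iq) - 1 = (1 + isz)/(1 - isz) = exp (2i arctan (sz))`, and `κ q dt/t` is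
the differential of `arctan (sz)`. -/
lemma hasDerivAt_cayley (h : IsCauchyPair κ p q) {t : ℝ} (ht : 0 < t) :
    HasDerivAt (fun t => (2 : ℝ) • (p t + I • q t) - 1)
      ((2 * I * κ : ℂ) • ((t⁻¹ • q t) * ((2 : ℝ) • (p t + I • q t) - 1))) t := by
  have h1 := (((h.hasDerivAt_p t ht).add ((h.hasDerivAt_q t ht).const_smul I)).const_smul
    (2 : ℝ)).sub_const (1 : 𝔸)
  refine h1.congr_deriv ?_
  simp only [mul_sub, mul_add, smul_mul_assoc, mul_smul_comm, h.mul_self t ht, h.comm t ht,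
    mul_one]
  have I2 : I * (I * (t : ℂ)⁻¹) = -(t : ℂ)⁻¹ := by rw [← mul_assoc, I_mul_I, neg_one_mul]
  simp only [← Complex.coe_smul, smul_sub, smul_add, smul_smul]
  push_cast
  simp only [div_eq_mul_inv]
  match_scalars <;> first
    | ring1
    | linear_combination (-4 * κ : ℂ) * I2
    | linear_combination (4 * κ : ℂ) * I2

lemma uIcc_subset {a b : ℝ} (ha : 0 < a) (hb : 0 < b) : uIcc a b ⊆ Ioi 0 :=
  fun _ ht => lt_of_lt_of_le (lt_min ha hb) ht.1

lemma intervalIntegral_pow_eq (h : IsCauchyPair κ p q) {a b : ℝ} (ha : 0 < a) (hb : 0 < b) :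
    (16 * κ) • (∫ t in a..b, t⁻¹ • q t ^ 3) =
      ((2 : ℝ) • q b - (4 : ℝ) • (p b * q b)) - ((2 : ℝ) • q a - (4 : ℝ) • (p a * q a)) +
        (2 * κ) • ∫ t in a..b, t⁻¹ • q t := by
  have hs := uIcc_subset ha hb
  have i1 : IntervalIntegrable (fun t => t⁻¹ • q t ^ 3) volume a b :=
    (h.continuousOn_inv_smul_pow.mono hs).intervalIntegrable
  have i2 : IntervalIntegrable (fun t => t⁻¹ • q t) volume a b :=
    (h.continuousOn_inv_smul.mono hs).intervalIntegrable
  have j1 : IntervalIntegrable (fun t => (16 * κ) • (t⁻¹ • q t ^ 3)) volume a b := i1.smul _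
  have j2 : IntervalIntegrable (fun t => (2 * κ) • (t⁻¹ • q t)) volume a b := i2.smul _
  have e : ∀ t, (κ / t) • ((16 : ℝ) • q t ^ 3 - (2 : ℝ) • q t) =
      (16 * κ) • (t⁻¹ • q t ^ 3) - (2 * κ) • (t⁻¹ • q t) := fun t => by
    simp only [div_eq_mul_inv]
    module
  have h1 := intervalIntegral.integral_eq_sub_of_hasDerivAt (a := a) (b := b)
    (fun t ht => h.hasDerivAt_boundary (hs ht)) (by
      simp only [e]
      exact j1.sub j2)
  simp only [e] at h1
  rw [intervalIntegral.integral_sub j1 j2, intervalIntegral.integral_smul,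
    intervalIntegral.integral_smul] at h1
  rw [← h1]
  abel

/-- The linear equation of `hasDerivAt_cayley` is solved by an integrating factor: all values of `q`
commute, so the product of `exp (X t)` with the Cayley transform has zero derivative. -/
lemma exp_intervalIntegral_mul (h : IsCauchyPair κ p q) {a b : ℝ} (ha : 0 < a) (hab : a ≤ b) :
    NormedSpace.exp ((2 * I * κ : ℂ) • ∫ t in a..b, t⁻¹ • q t) *
      ((2 : ℝ) • (p a + I • q a) - 1) = (2 : ℝ) • (p b + I • q b) - 1 := by
  let _ : NormedAlgebra ℚ 𝔸 := NormedAlgebra.restrictScalars ℚ ℂ 𝔸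
  set U : ℝ → 𝔸 := fun t => (2 : ℝ) • (p t + I • q t) - 1 with hU
  set X : ℝ → 𝔸 := fun t => -((2 * I * κ : ℂ) • ∫ r in a..t, r⁻¹ • q r) with hX
  have hii : ∀ t, 0 < t → IntervalIntegrable (fun r => r⁻¹ • q r) volume a t := fun t ht =>
    (h.continuousOn_inv_smul.mono (uIcc_subset ha ht)).intervalIntegrable
  have hcq : ∀ r, 0 < r → ∀ t, 0 < t → Commute (q r) (X t) := fun r hr t ht =>
    ((commute_intervalIntegral (hii t ht) fun s hs =>
      (h.commute r s hr (uIcc_subset ha ht hs)).smul_right _).smul_right _).neg_right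
  have hcX : ∀ s t, 0 < s → 0 < t → Commute (X t) (X s) := fun s t hs ht =>
    ((commute_intervalIntegral (hii s hs) fun r hr =>
      ((hcq r (uIcc_subset ha hs hr) t ht).symm.smul_right _)).smul_right _).neg_right
  have hdX : ∀ t, 0 < t → HasDerivAt X (-((2 * I * κ : ℂ) • (t⁻¹ • q t))) t := fun t ht =>
    ((intervalIntegral.integral_hasDerivAt_right (hii t ht)
      (h.continuousOn_inv_smul.stronglyMeasurableAtFilter isOpen_Ioi t ht)
      (h.continuousOn_inv_smul.continuousAt (Ioi_mem_nhds ht))).const_smul (2 * I * κ : ℂ)).neg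
  have hE : ∀ t, 0 < t → HasDerivAt (fun t => NormedSpace.exp (X t) * U t) 0 t := fun t ht => by
    have h1 := (hasDerivAt_exp_of_commute (hdX t ht)
      (mem_of_superset (Ioi_mem_nhds ht) fun r hr => hcX r t hr ht)).mul (h.hasDerivAt_cayley ht)
    refine h1.congr_deriv ?_
    simp only [mul_neg, neg_mul, mul_smul_comm, smul_mul_assoc, mul_assoc]
    exact neg_add_cancel _
  have hconst := constant_of_has_deriv_right_zero (a := a) (b := b)
    (fun t ht => (hE t (ha.trans_le ht.1)).continuousAt.continuousWithinAt)
    (fun t ht => (hE t (ha.trans_le ht.1)).hasDerivWithinAt) b ⟨hab, le_rfl⟩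
  have hXa : X a = 0 := by simp [hX]
  simp only [hXa, NormedSpace.exp_zero, one_mul] at hconst
  change _ * U a = U b
  rw [← hconst, ← mul_assoc, ← NormedSpace.exp_add_of_commute (Commute.refl _).neg_right,
    add_neg_cancel, NormedSpace.exp_zero, one_mul]

end IsCauchyPair

end BanachAlgebra

/-- The substitution `v = u ^ k` reduces the integral to `k⁻¹ ∫₀^∞ v² (1 + v²)⁻³ dv = π / (16k)`.
The exact value matters: it produces the `π` in `exp (iπS) = -I`. -/
lemma sgnConst_eq {k : ℕ} (hk : 1 ≤ k) : sgnConst k = 16 * k / Real.pi := by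
  have hk0 : (k : ℝ) ≠ 0 := by positivity
  -- A primitive of `v² / (1 + v²)³`; only the arctangent contributes at infinity.
  set G : ℝ → ℝ := fun v => Real.arctan v / 8 + v / (8 * (1 + v ^ 2)) - v / (4 * (1 + v ^ 2) ^ 2)
    with hG
  have hGd : ∀ v, HasDerivAt G (v ^ 2 / (1 + v ^ 2) ^ 3) v := by
    intro v
    have hv : (1 + v ^ 2) ≠ 0 := by positivity
    have d0 : HasDerivAt (fun v : ℝ => 1 + v ^ 2) (2 * v) v := by
      simpa using (hasDerivAt_pow 2 v).const_add 1
    have d1 := (Real.hasDerivAt_arctan v).div_const 8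
    have d2 := (hasDerivAt_id v).div (d0.const_mul 8) (by positivity)
    have d3 := (hasDerivAt_id v).div ((d0.pow 2).const_mul 4)
      (mul_ne_zero four_ne_zero (pow_ne_zero 2 hv))
    refine ((d1.add d2).sub d3).congr_deriv ?_
    simp only [id, Pi.pow_apply]
    field_simp
    ring
  have hF : ∀ u : ℝ, HasDerivAt (fun u : ℝ => G (u ^ k) / k)
      (u ^ (3 * k - 1) / (1 + u ^ (2 * k)) ^ 3) u := by
    intro u
    have h1 := ((hGd (u ^ k)).comp u (hasDerivAt_pow k u)).div_const (k : ℝ)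
    refine h1.congr_deriv ?_
    rw [show 3 * k - 1 = k * 2 + (k - 1) by omega, pow_add, pow_mul, show 2 * k = k * 2 by ring,
      pow_mul u k 2]
    field_simp
  have hlim : Tendsto G atTop (𝓝 (Real.pi / 2 / 8 + 0 - 0)) := by
    have ha : Tendsto Real.arctan atTop (𝓝 (Real.pi / 2)) :=
      Real.tendsto_arctan_atTop.mono_right nhdsWithin_le_nhds
    have hb : Tendsto (fun v : ℝ => v⁻¹) atTop (𝓝 0) := tendsto_inv_atTop_zero
    refine ((ha.div_const 8).add ?_).sub ?_
    · refine squeeze_zero' ?_ ?_ hb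
      · filter_upwards [eventually_gt_atTop 0] with v hv
        positivity
      · filter_upwards [eventually_gt_atTop 0] with v hv
        rw [div_le_iff₀ (by positivity)]
        field_simp
        nlinarith
    · refine squeeze_zero' ?_ ?_ hb
      · filter_upwards [eventually_gt_atTop 0] with v hv
        positivity
      · filter_upwards [eventually_gt_atTop 0] with v hv
        rw [div_le_iff₀ (by positivity)]
        field_simp
        nlinarith [sq_nonneg (v ^ 2)]
  have hlim' : Tendsto (fun u : ℝ => G (u ^ k) / k) atTop
      (𝓝 ((Real.pi / 2 / 8 + 0 - 0) / k)) :=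
    (hlim.comp (tendsto_pow_atTop (by omega))).div_const _
  have hint := integral_Ioi_of_hasDerivAt_of_nonneg' (a := 0) (fun u _ => hF u)
    (fun u hu => by have : (0 : ℝ) < u := hu; positivity) hlim'
  rw [sgnConst, hint, hG]
  simp [show k ≠ 0 by omega]
  field_simp
  norm_num

/-- `(I + s² T²)⁻¹` in terms of the resolvents `R s = (I + i s T)⁻¹`. -/
noncomputable def resP (R : ℝ → H →L[ℂ] H) (s : ℝ) : H →L[ℂ] H := (2 : ℂ)⁻¹ • (R s + R (-s))

/-- The products `R s * R (-s)` equal the half sum of the two resolvents, so every identity becomes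
linear in `R s`, `R (-s)` and their squares. -/
lemma IsResolventFamily.isCauchyPair {T : H →ₗ.[ℂ] H} {R : ℝ → H →L[ℂ] H} {M : ℝ}
    (h : IsResolventFamily T R M) {k : ℕ} (hk : 1 ≤ k) :
    IsCauchyPair (k : ℝ) (fun t => resP R (t ^ k)) (fun t => resQ R (t ^ k)) := by
  have hs : ∀ t : ℝ, 0 < t → t ^ k ≠ 0 := fun t ht => (pow_pos ht k).ne'
  have hn : ∀ t : ℝ, 0 < t → -t ^ k ≠ 0 := fun t ht => neg_ne_zero.2 (hs t ht)
  have hab : ∀ t : ℝ, 0 < t → R (t ^ k) * R (-t ^ k) = (2 : ℂ)⁻¹ • (R (t ^ k) + R (-t ^ k)) := by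
    intro t ht
    rw [h.add_neg_eq (hs t ht), ← Complex.coe_smul, smul_smul]
    norm_num
  have hba : ∀ t : ℝ, 0 < t → R (-t ^ k) * R (t ^ k) = (2 : ℂ)⁻¹ • (R (t ^ k) + R (-t ^ k)) := by
    intro t ht
    rw [← hab t ht, (h.commute (hs t ht) (hn t ht)).eq]
  have e1 : ∀ t : ℝ, 0 < t → k * t ^ (k - 1) * (t ^ k)⁻¹ = k / t := by
    intro t ht
    have := ht.ne'
    obtain ⟨j, rfl⟩ : ∃ j, k = j + 1 := ⟨k - 1, by omega⟩
    rw [Nat.add_sub_cancel, pow_succ]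
    field_simp
  have da : ∀ t : ℝ, 0 < t → HasDerivAt (fun t : ℝ => R (t ^ k))
      (((k / t : ℝ) : ℂ) • (R (t ^ k) * R (t ^ k) - R (t ^ k))) t := by
    intro t ht
    refine ((h.hasDerivAt (hs t ht)).scomp t (hasDerivAt_pow k t)).congr_deriv ?_
    rw [smul_smul, e1 t ht, Complex.coe_smul]
  have db : ∀ t : ℝ, 0 < t → HasDerivAt (fun t : ℝ => R (-t ^ k))
      (((k / t : ℝ) : ℂ) • (R (-t ^ k) * R (-t ^ k) - R (-t ^ k))) t := by
    intro t ht
    refine ((h.hasDerivAt (hn t ht)).scomp t (hasDerivAt_pow k t).neg).congr_deriv ?_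
    rw [smul_smul, inv_neg, neg_mul_neg, e1 t ht, Complex.coe_smul]
  have hI : (2 * I : ℂ)⁻¹ * (2 * I)⁻¹ = -4⁻¹ := by
    rw [← mul_inv, show (2 * I * (2 * I) : ℂ) = -4 by linear_combination 4 * I_mul_I, inv_neg]
  refine ⟨fun t ht => ?_, fun t ht => ?_, fun t ht => ?_, fun t ht => ?_, fun s t hs0 ht => ?_⟩
  · refine (((da t ht).add (db t ht)).const_smul (2 : ℂ)⁻¹).congr_deriv ?_
    simp only [resP, mul_add, add_mul, smul_mul_assoc, mul_smul_comm, hab t ht, hba t ht,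
      ← Complex.coe_smul]
    push_cast
    module
  · refine (((db t ht).sub (da t ht)).const_smul (2 * I : ℂ)⁻¹).congr_deriv ?_
    simp only [resP, resQ, mul_add, mul_sub, sub_mul, smul_mul_assoc, mul_smul_comm, hab t ht,
      hba t ht, ← Complex.coe_smul, mul_one]
    push_cast
    module
  · simp only [resP, resQ, mul_add, add_mul, mul_sub, sub_mul, smul_mul_assoc, mul_smul_comm,
      hab t ht, hba t ht]
    generalize (2 * I : ℂ)⁻¹ = c at hI
    match_scalars <;> first
      | linear_combination hI
      | linear_combination -hI
  · simp only [resP, resQ, mul_add, add_mul, mul_sub, sub_mul, smul_mul_assoc, mul_smul_comm,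
      hab t ht, hba t ht]
    module
  · have c := fun {x y : ℝ} (hx : x ≠ 0) (hy : y ≠ 0) => h.commute hx hy
    exact ((((c (hn s hs0) (hn t ht)).sub_right (c (hn s hs0) (hs t ht))).sub_left
      ((c (hs s hs0) (hn t ht)).sub_right (c (hs s hs0) (hs t ht)))).smul_left _).smul_right _

/-! ### Square function estimates and uniform bounds -/

lemma intervalIntegral_le_of_lintegral_le {g : ℝ → H} (hg : ContinuousOn g (Ioi 0)) {c : ℝ}
    (hc : 0 ≤ c) (h : ∫⁻ t in Ioi (0 : ℝ), ‖g t‖ₑ ^ 2 / ENNReal.ofReal t ≤ ENNReal.ofReal c)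
    {a b : ℝ} (ha : 0 < a) (hab : a ≤ b) : ∫ t in a..b, t⁻¹ * ‖g t‖ ^ 2 ≤ c := by
  have hsub : Ioc a b ⊆ Ioi 0 := fun t ht => ha.trans ht.1
  rw [intervalIntegral.integral_of_le hab, ← ENNReal.ofReal_le_ofReal_iff hc]
  have hcont : ContinuousOn (fun t : ℝ => t⁻¹ * ‖g t‖ ^ 2) (Ioi 0) :=
    (continuousOn_inv₀.mono fun _ ht => ne_of_gt ht).mul (hg.norm.pow 2)
  have hint : IntegrableOn (fun t : ℝ => t⁻¹ * ‖g t‖ ^ 2) (Ioc a b) :=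
    ((hcont.mono fun t ht => ha.trans_le ht.1).integrableOn_Icc (μ := volume)).mono_set
      Ioc_subset_Icc_self
  rw [ofReal_integral_eq_lintegral_ofReal hint
    ((ae_restrict_iff' measurableSet_Ioc).2 (Eventually.of_forall fun t ht => by
      have : (0 : ℝ) < t := hsub ht
      simp only [Pi.zero_apply]
      positivity))]
  refine le_trans ?_ h
  refine le_trans (le_of_eq ?_) (lintegral_mono_set hsub)
  refine setLIntegral_congr_fun measurableSet_Ioc fun t ht => ?_
  have : (0 : ℝ) < t := hsub ht
  rw [ENNReal.ofReal_mul (by positivity), ENNReal.ofReal_inv_of_pos this, mul_comm,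
    ENNReal.ofReal_pow (norm_nonneg _), ofReal_norm, ENNReal.div_eq_inv_mul, mul_comm]

/-- Duality: square function bounds for `q` and its adjoint control `∫ q³ dt/t`. -/
lemma norm_intervalIntegral_pow_le {q : ℝ → H →L[ℂ] H} (hq : ContinuousOn q (Ioi 0)) {M : ℝ}
    (hM : ∀ t, 0 < t → ‖q t‖ ≤ M) {g : H → ℝ → H} (hg : ∀ x, ContinuousOn (g x) (Ioi 0))
    (hqg : ∀ x t, 0 < t → ‖ContinuousLinearMap.adjoint (q t) x‖ ≤ ‖g x t‖) {C C' : ℝ}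
    (hC0 : 0 ≤ C) (hC0' : 0 ≤ C')
    {a b : ℝ} (ha : 0 < a) (hab : a ≤ b)
    (hC : ∀ x, ∫ t in a..b, t⁻¹ * ‖q t x‖ ^ 2 ≤ C * ‖x‖ ^ 2)
    (hC' : ∀ x, ∫ t in a..b, t⁻¹ * ‖g x t‖ ^ 2 ≤ C' * ‖x‖ ^ 2) :
    ‖∫ t in a..b, t⁻¹ • q t ^ 3‖ ≤ Real.sqrt ((C' + 1) * (M ^ 2 * C)) := by
  have hs : uIcc a b ⊆ Ioi 0 := fun _ ht => (lt_min ha (ha.trans_le hab)).trans_le ht.1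
  have hs' : ∀ t ∈ Icc a b, 0 < t := fun t ht => ha.trans_le ht.1
  have hinv : ContinuousOn (fun t : ℝ => t⁻¹) (Ioi 0) :=
    continuousOn_inv₀.mono fun _ ht => ne_of_gt ht
  have hqx : ∀ x, ContinuousOn (fun t => q t x) (Ioi 0) := fun x => hq.clm_apply continuousOn_const
  have hcΦ : ContinuousOn (fun t : ℝ => t⁻¹ • q t ^ 3) (Ioi 0) := hinv.smul (hq.pow 3)
  refine ContinuousLinearMap.opNorm_le_bound _ (Real.sqrt_nonneg _) fun f => ?_
  set x : H := (∫ t in a..b, t⁻¹ • q t ^ 3) f with hx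
  have e1 : x = ∫ t in a..b, (t⁻¹ • q t ^ 3) f := by
    rw [hx]
    exact ((ContinuousLinearMap.apply ℂ H f).intervalIntegral_comp_comm
      ((hcΦ.mono hs).intervalIntegrable)).symm
  have e2 : inner ℂ x x = ∫ t in a..b, inner ℂ x ((t⁻¹ • q t ^ 3) f) := by
    nth_rewrite 2 [e1]
    exact ((innerSL ℂ x).intervalIntegral_comp_comm
      (((hcΦ.clm_apply continuousOn_const).mono hs).intervalIntegrable)).symm
  -- The weight in Young's inequality, chosen so that `ε C' ≤ 1` and the term in `‖x‖²` is absorbed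
  -- on the left; the `+ 1` covers `C' = 0`.
  set ε : ℝ := (C' + 1)⁻¹ with hε
  have hε0 : 0 < ε := by positivity
  have hM0 : 0 ≤ M := (norm_nonneg _).trans (hM a ha)
  have i1 : IntervalIntegrable (fun t => ε / 2 * (t⁻¹ * ‖g x t‖ ^ 2)) volume a b :=
    ((continuousOn_const.mul (hinv.mul ((hg x).norm.pow 2))).mono hs).intervalIntegrable
  have i2 : IntervalIntegrable (fun t => ε⁻¹ / 2 * M ^ 2 * (t⁻¹ * ‖q t f‖ ^ 2)) volume a b :=
    ((continuousOn_const.mul (hinv.mul ((hqx f).norm.pow 2))).mono hs).intervalIntegrable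
  have hpt : ∀ t ∈ Icc a b, ‖inner ℂ x ((t⁻¹ • q t ^ 3) f)‖ ≤
      ε / 2 * (t⁻¹ * ‖g x t‖ ^ 2) + ε⁻¹ / 2 * M ^ 2 * (t⁻¹ * ‖q t f‖ ^ 2) := by
    intro t ht
    have ht0 := hs' t ht
    -- One factor of `q` moves to `x`, one stays on `f` for its square function, and the middle one
    -- is merely bounded by `M`.
    have h1 : inner ℂ x ((t⁻¹ • q t ^ 3) f) =
        (t⁻¹ : ℝ) • inner ℂ (ContinuousLinearMap.adjoint (q t) x) (q t (q t f)) := by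
      rw [ContinuousLinearMap.adjoint_inner_left, pow_succ, sq, _root_.smul_apply]
      exact inner_smul_right_eq_smul _ _ _
    rw [h1, norm_smul, Real.norm_of_nonneg (by positivity)]
    have h2 : ‖inner ℂ (ContinuousLinearMap.adjoint (q t) x) (q t (q t f))‖ ≤
        ‖g x t‖ * (M * ‖q t f‖) :=
      (norm_inner_le_norm _ _).trans (mul_le_mul (hqg x t ht0)
        ((q t).le_of_opNorm_le (hM t ht0) _) (norm_nonneg _) (norm_nonneg _))
    have h3 : ‖g x t‖ * (M * ‖q t f‖) ≤
        ε / 2 * ‖g x t‖ ^ 2 + ε⁻¹ / 2 * (M * ‖q t f‖) ^ 2 := by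
      have := sq_nonneg (ε * ‖g x t‖ - M * ‖q t f‖)
      field_simp
      linarith
    calc t⁻¹ * _ ≤ t⁻¹ * (ε / 2 * ‖g x t‖ ^ 2 + ε⁻¹ / 2 * (M * ‖q t f‖) ^ 2) :=
          mul_le_mul_of_nonneg_left (h2.trans h3) (by positivity)
      _ = _ := by ring
  have h4 : ‖x‖ ^ 2 ≤ ε / 2 * (C' * ‖x‖ ^ 2) + ε⁻¹ / 2 * M ^ 2 * (C * ‖f‖ ^ 2) := by
    calc ‖x‖ ^ 2 = ‖inner ℂ x x‖ := by
          rw [inner_self_eq_norm_sq_to_K]; simp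
      _ ≤ ∫ t in a..b, (ε / 2 * (t⁻¹ * ‖g x t‖ ^ 2) + ε⁻¹ / 2 * M ^ 2 * (t⁻¹ * ‖q t f‖ ^ 2)) := by
          rw [e2]
          exact intervalIntegral.norm_integral_le_of_norm_le hab
            (Eventually.of_forall fun t ht => hpt t (Ioc_subset_Icc_self ht)) (i1.add i2)
      _ = ε / 2 * (∫ t in a..b, t⁻¹ * ‖g x t‖ ^ 2) +
            ε⁻¹ / 2 * M ^ 2 * ∫ t in a..b, t⁻¹ * ‖q t f‖ ^ 2 := by
          rw [intervalIntegral.integral_add i1 i2, intervalIntegral.integral_const_mul,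
            intervalIntegral.integral_const_mul]
      _ ≤ _ := by
          gcongr
          exacts [hC' x, hC f]
  have h5 : ε * C' ≤ 1 := by
    rw [hε, inv_mul_le_iff₀ (by positivity)]; linarith
  have h6 : ‖x‖ ^ 2 ≤ (C' + 1) * (M ^ 2 * C) * ‖f‖ ^ 2 := by
    have h7 : ε * C' * ‖x‖ ^ 2 ≤ 1 * ‖x‖ ^ 2 := by gcongr
    have h8 : ε⁻¹ = C' + 1 := inv_inv _
    rw [h8] at h4
    linarith
  rw [← Real.sqrt_sq (norm_nonneg x), ← Real.sqrt_sq (norm_nonneg f), ← Real.sqrt_mul (by positivity)]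
  exact Real.sqrt_le_sqrt h6

/-! ### Exponentials of strongly convergent sequences -/

lemma tendsto_pow_apply {A : ℕ → H →L[ℂ] H} {A₀ : H →L[ℂ] H} {K : ℝ} (hK : ∀ n, ‖A n‖ ≤ K)
    {Y : Set H} (hY : ∀ y ∈ Y, A₀ y ∈ Y)
    (hA : ∀ y ∈ Y, Tendsto (fun n => A n y) atTop (𝓝 (A₀ y))) (j : ℕ) {y : H} (hy : y ∈ Y) :
    Tendsto (fun n => (A n ^ j) y) atTop (𝓝 ((A₀ ^ j) y)) := by
  have hmem : ∀ j, (A₀ ^ j) y ∈ Y := fun j => by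
    induction j with
    | zero => simpa using hy
    | succ j ih => rw [pow_succ']; exact hY _ ih
  induction j with
  | zero => simp
  | succ j ih =>
    have h1 : Tendsto (fun n => A n ((A n ^ j) y - (A₀ ^ j) y)) atTop (𝓝 0) := by
      refine squeeze_zero_norm (fun n => (A n).le_of_opNorm_le (hK n) _) ?_
      simpa using (tendsto_iff_norm_sub_tendsto_zero.1 ih).const_mul K
    have h2 := h1.add (hA _ (hmem j))
    rw [zero_add] at h2
    rw [pow_succ']
    refine h2.congr fun n => ?_
    rw [pow_succ', map_sub, sub_add_cancel]
    rfl

/-- Dominated convergence in the exponential series. Strong convergence is known only on `Y`, so `Y`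
must be invariant under the limit for powers to converge. -/
lemma tendsto_exp_apply {A : ℕ → H →L[ℂ] H} {A₀ : H →L[ℂ] H} {K : ℝ} (hK : ∀ n, ‖A n‖ ≤ K)
    {Y : Set H} (hY : ∀ y ∈ Y, A₀ y ∈ Y)
    (hA : ∀ y ∈ Y, Tendsto (fun n => A n y) atTop (𝓝 (A₀ y))) {y : H} (hy : y ∈ Y) :
    Tendsto (fun n => NormedSpace.exp (A n) y) atTop (𝓝 (NormedSpace.exp A₀ y)) := by
  have hexp : ∀ X : H →L[ℂ] H,
      NormedSpace.exp X y = ∑' j : ℕ, ((j.factorial : ℂ)⁻¹ • X ^ j) y := fun X =>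
    ((ContinuousLinearMap.apply ℂ H y).hasSum
      (NormedSpace.exp_series_hasSum_exp' (𝕂 := ℂ) X)).tsum_eq.symm
  simp only [hexp]
  refine tendsto_tsum_of_dominated_convergence
    (bound := fun j => K ^ j / (j.factorial : ℝ) * ‖y‖) ?_ (fun j => ?_)
    (Eventually.of_forall fun n j => ?_)
  · exact (Real.summable_pow_div_factorial K).mul_right _
  · exact (tendsto_pow_apply hK hY hA j hy).const_smul _
  · rw [_root_.smul_apply, norm_smul, norm_inv, Complex.norm_natCast, div_eq_inv_mul, mul_assoc]
    gcongr
    have hK0 : 0 ≤ K := (norm_nonneg _).trans (hK n)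
    induction j with
    | zero => simp
    | succ j ih =>
      rw [pow_succ', pow_succ', mul_assoc]
      exact ((A n).le_of_opNorm_le (hK n) _).trans (mul_le_mul_of_nonneg_left ih hK0)

lemma apply_exp_of_intertwining {E : Type*} [NormedAddCommGroup E] [NormedSpace ℂ E]
    [CompleteSpace E] {A : H →L[ℂ] H} {A' : E →L[ℂ] E} {J : E →L[ℂ] H}
    (h : ∀ y, J (A' y) = A (J y)) (y : E) : J (NormedSpace.exp A' y) = NormedSpace.exp A (J y) := by
  have hp : ∀ (j : ℕ) (y : E), J ((A' ^ j) y) = (A ^ j) (J y) := fun j => by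
    induction j with
    | zero => intro y; rfl
    | succ j ih =>
      intro y
      rw [pow_succ, pow_succ]
      exact (ih _).trans (congrArg (A ^ j) (h y))
  have h1 := (J ∘L ContinuousLinearMap.apply ℂ E y).hasSum
    (NormedSpace.exp_series_hasSum_exp' (𝕂 := ℂ) A')
  have h2 := (ContinuousLinearMap.apply ℂ H (J y)).hasSum
    (NormedSpace.exp_series_hasSum_exp' (𝕂 := ℂ) A)
  refine h1.unique (h2.congr_fun fun j => ?_)
  change J ((j.factorial : ℂ)⁻¹ • (A' ^ j) y) = (j.factorial : ℂ)⁻¹ • (A ^ j) (J y)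
  rw [map_smul, hp]

/-- An operator whose exponential is `-I` is invertible. -/
lemma isUnit_of_exp_eq_neg_one {𝔸 : Type*} [NormedRing 𝔸] [NormedAlgebra ℂ 𝔸] [CompleteSpace 𝔸]
    {a : 𝔸} (h : NormedSpace.exp a = -1) : IsUnit a := by
  rcases subsingleton_or_nontrivial 𝔸 with h0 | h0
  · exact isUnit_of_subsingleton a
  by_contra hu
  -- If `0` were in the spectrum of `a`, then `1 = exp 0` would be in the spectrum of `-1`.
  have h1 := spectrum.exp_mem_exp a ((spectrum.zero_mem_iff ℂ).2 hu)
  rw [h, NormedSpace.exp_zero] at h1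
  have h2 : (-1 : 𝔸) = algebraMap ℂ 𝔸 (-1) := by simp
  rw [h2, spectrum.scalar_eq] at h1
  norm_num at h1

/-- The graph of a bounded operator is closed, and its part over a dense subspace is dense in it. -/
lemma closure_eq_toPMap_of_dense {T : H →ₗ.[ℂ] H} (hT : Dense (T.domain : Set H)) {S : H →L[ℂ] H}
    (h : ∀ x : T.domain, T x = S x) : T.closure = (S : H →ₗ[ℂ] H).toPMap ⊤ := by
  have hmem : ∀ x y : H, (x, y) ∈ ((S : H →ₗ[ℂ] H).toPMap ⊤).graph ↔ S x = y := by
    intro x y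
    rw [LinearPMap.mem_graph_iff]
    constructor
    · rintro ⟨z, rfl, hz⟩
      exact hz
    · rintro rfl
      exact ⟨⟨x, trivial⟩, rfl, rfl⟩
  have hg : T.graph.topologicalClosure = ((S : H →ₗ[ℂ] H).toPMap ⊤).graph := by
    refine le_antisymm (Submodule.topologicalClosure_minimal _ ?_ ?_) ?_
    · rintro ⟨x, y⟩ hxy
      obtain ⟨z, rfl, rfl⟩ := (LinearPMap.mem_graph_iff _).1 hxy
      exact (hmem _ _).2 (h z).symm
    · have : (((S : H →ₗ[ℂ] H).toPMap ⊤).graph : Set (H × H)) = {x | S x.1 = x.2} := by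
        ext x
        exact hmem x.1 x.2
      rw [this]
      exact isClosed_eq (by fun_prop) (by fun_prop)
    · rintro ⟨x, y⟩ hxy
      rw [hmem] at hxy
      subst hxy
      have hc : Continuous fun x : H => (x, S x) := by fun_prop
      refine closure_mono ?_ (image_closure_subset_closure_image hc ⟨x, hT x, rfl⟩)
      rintro _ ⟨z, hz, rfl⟩
      exact (LinearPMap.mem_graph_iff _).2 ⟨⟨z, hz⟩, rfl, h ⟨z, hz⟩⟩
  have hcl : T.IsClosable := ⟨_, hg⟩
  exact LinearPMap.eq_of_eq_graph (hcl.graph_closure_eq_closure_graph.symm.trans hg)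

/-! ### Absolute convergence of the integral and bounds for its terms -/

namespace IsResolventFamily

variable {T : H →ₗ.[ℂ] H} {R : ℝ → H →L[ℂ] H} {M : ℝ} {k : ℕ}

lemma sgnIntegrand_eq (h : IsResolventFamily T R M) (f : H) {t : ℝ} (ht : 0 < t) :
    sgnIntegrand k T f t = (t⁻¹ • resQ R (t ^ k) ^ 3) f := by
  rw [sgnIntegrand, h.qOp_eq (pow_pos ht k).ne', _root_.smul_apply, ← Complex.coe_smul]
  push_cast
  rfl

lemma norm_inv_smul_pow_apply_le (h : IsResolventFamily T R M) (f : H) {t : ℝ} (ht : 0 < t) :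
    ‖(t⁻¹ • resQ R (t ^ k) ^ 3) f‖ ≤ t⁻¹ * (M * (M * ‖resQ R (t ^ k) f‖)) := by
  have hM := h.norm_resQ_le (pow_pos ht k).ne'
  rw [_root_.smul_apply, norm_smul, Real.norm_of_nonneg (by positivity), pow_succ, sq]
  gcongr
  refine ((resQ R (t ^ k)).le_of_opNorm_le hM _).trans ?_
  have := h.nonneg
  gcongr
  exact (resQ R (t ^ k)).le_of_opNorm_le hM _

/-- The null space part contributes nothing. For the rest, the domain gives decay `t ^ k` on `(0,
1]` and the range gives `t ^ (-k)` beyond; `k ≥ 1` makes both integrable against `dt/t`. -/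
lemma integrableOn (h : IsResolventFamily T R M) (hk : 1 ≤ k) {f : H}
    (hf : f ∈ nul T ⊔ (T.domain ⊓ ran T)) :
    IntegrableOn (fun t : ℝ => (t⁻¹ • resQ R (t ^ k) ^ 3) f) (Ioi 0) := by
  obtain ⟨n, hn, g, ⟨hg1, hg2⟩, rfl⟩ := Submodule.mem_sup.1 hf
  have hM := h.nonneg
  have hg3 := LinearPMap.mem_graph T ⟨g, hg1⟩
  set v := T ⟨g, hg1⟩
  obtain ⟨u, hu⟩ := mem_ran.1 hg2
  have hcont := ((h.isCauchyPair hk).continuousOn_inv_smul_pow).clm_apply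
    (continuousOn_const (c := n + g))
  have hq : ∀ t : ℝ, 0 < t → resQ R (t ^ k) (n + g) = resQ R (t ^ k) g := fun t ht => by
    rw [map_add, h.resQ_apply_of_mem_nul (pow_pos ht k).ne' (mem_nul.1 hn), zero_add]
  rw [← Ioc_union_Ioi_eq_Ioi zero_le_one]
  refine IntegrableOn.union ?_ ?_
  · refine Integrable.mono' (g := fun _ => M * (M * (M * ‖v‖))) (integrableOn_const (by simp))
      ((hcont.mono fun t ht => ht.1).aestronglyMeasurable measurableSet_Ioc) ?_
    refine (ae_restrict_iff' measurableSet_Ioc).2 (Eventually.of_forall fun t ht => ?_)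
    have ht0 : 0 < t := ht.1
    refine (h.norm_inv_smul_pow_apply_le _ ht0).trans ?_
    rw [hq t ht0, inv_mul_le_iff₀ ht0]
    have h1 := h.norm_resQ_apply_le (pow_pos ht0 k).ne' hg3
    rw [abs_of_pos (pow_pos ht0 k)] at h1
    have h2 : t ^ k ≤ t := pow_le_of_le_one ht0.le ht.2 (by omega)
    calc M * (M * ‖resQ R (t ^ k) g‖) ≤ M * (M * (t ^ k * (M * ‖v‖))) := by gcongr
      _ ≤ M * (M * (t * (M * ‖v‖))) := by gcongr
      _ = _ := by ring
  · refine Integrable.mono' (g := fun t : ℝ => t ^ (-2 : ℝ) * (M * (M * ((1 + M) * ‖u‖))))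
      ((integrableOn_Ioi_rpow_of_lt (by norm_num) one_pos).mul_const _)
      ((hcont.mono fun t (ht : 1 < t) => one_pos.trans ht).aestronglyMeasurable measurableSet_Ioi) ?_
    refine (ae_restrict_iff' measurableSet_Ioi).2 (Eventually.of_forall fun t (ht : 1 < t) => ?_)
    have ht0 : 0 < t := one_pos.trans ht
    refine (h.norm_inv_smul_pow_apply_le _ ht0).trans ?_
    have h1 := h.norm_resQ_ran_le (pow_pos ht0 k).ne' hu
    rw [abs_of_pos (pow_pos ht0 k)] at h1
    have h2 : (t ^ k)⁻¹ ≤ t⁻¹ := inv_anti₀ ht0 (le_self_pow₀ ht.le (by omega))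
    rw [hq t ht0, Real.rpow_neg ht0.le, Real.rpow_two]
    calc t⁻¹ * (M * (M * ‖resQ R (t ^ k) g‖))
        ≤ t⁻¹ * (M * (M * ((t ^ k)⁻¹ * ((1 + M) * ‖u‖)))) := by gcongr
      _ ≤ t⁻¹ * (M * (M * (t⁻¹ * ((1 + M) * ‖u‖)))) := by gcongr
      _ = _ := by ring

lemma domain_sgnCore (h : IsResolventFamily T R M) (hk : 1 ≤ k) :
    (sgnCore k T).domain = nul T ⊔ (T.domain ⊓ ran T) := by
  ext f
  refine ⟨fun hf => hf.1, fun hf => ⟨hf, ?_⟩⟩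
  exact (h.integrableOn hk hf).congr_fun (fun t ht => (h.sgnIntegrand_eq f ht).symm)
    measurableSet_Ioi

lemma sgnCore_apply (h : IsResolventFamily T R M) (f : (sgnCore k T).domain) :
    sgnCore k T f =
      (sgnConst k : ℂ) • ∫ t in Ioi (0 : ℝ), (t⁻¹ • resQ R (t ^ k) ^ 3) (f : H) :=
  congrArg ((sgnConst k : ℂ) • ·)
    (setIntegral_congr_fun measurableSet_Ioi fun _ ht => h.sgnIntegrand_eq _ ht)

lemma exists_integral_bound (h : IsResolventFamily T R M) (hk : 1 ≤ k)
    (hquad : QuadraticEstimate k T) : ∃ C : ℝ, 0 ≤ C ∧ ∀ a b : ℝ, 0 < a → a ≤ b → ∀ x,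
      ∫ t in a..b, t⁻¹ * ‖resQ R (t ^ k) x‖ ^ 2 ≤ C * ‖x‖ ^ 2 := by
  obtain ⟨C, hC⟩ := hquad
  refine ⟨C, C.2, fun a b ha hab x => ?_⟩
  refine intervalIntegral_le_of_lintegral_le
    ((h.isCauchyPair hk).continuousOn_q.clm_apply continuousOn_const)
    (by positivity) ?_ ha hab
  refine le_trans (le_of_eq ?_) ((hC x).trans (le_of_eq ?_))
  · refine setLIntegral_congr_fun measurableSet_Ioi fun t (ht : 0 < t) => ?_
    simp only [h.qOp_eq (pow_pos ht k).ne']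
  · rw [ENNReal.ofReal_mul C.coe_nonneg, ENNReal.ofReal_pow (norm_nonneg _), ofReal_norm,
      ENNReal.ofReal_coe_nnreal]

lemma norm_resP_le (h : IsResolventFamily T R M) {s : ℝ} (hs : s ≠ 0) : ‖resP R s‖ ≤ M := by
  have h1 := norm_add_le (R s) (R (-s))
  have h2 := h.norm_le s hs
  have h3 := h.norm_le (-s) (neg_ne_zero.2 hs)
  rw [resP, norm_smul]
  simp only [norm_inv, Complex.norm_ofNat]
  linarith

lemma cayley_mul_cayley (h : IsResolventFamily T R M) {s : ℝ} (hs : s ≠ 0) :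
    ((2 : ℝ) • R (-s) - 1) * ((2 : ℝ) • R s - 1) = 1 := by
  have h1 := h.add_neg_eq hs
  rw [(h.commute hs (neg_ne_zero.2 hs)).eq] at h1
  have h2 : R (-s) * R s = (2 : ℝ)⁻¹ • (R s + R (-s)) := by
    rw [h1, smul_smul]; norm_num
  simp only [mul_sub, sub_mul, smul_mul_assoc, mul_smul_comm, h2, mul_one, one_mul]
  module

end IsResolventFamily

/-! ### Uniform bound for the truncated integrals -/

section Perturbation

variable {D : H →ₗ.[ℂ] H} {B : H →L[ℂ] H} {δ : ℝ} {R R' : ℝ → H →L[ℂ] H} {M M' : ℝ} {k : ℕ}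

lemma exists_norm_intervalIntegral_le (hD : IsSelfAdjoint D) (hδ : 0 < δ)
    (hB : AccretiveWith δ B D) (h : IsResolventFamily (mulOp B D) R M)
    (h' : IsResolventFamily (mulOp (ContinuousLinearMap.adjoint B) D) R' M') (hk : 1 ≤ k)
    (hquad : QuadraticEstimate k (mulOp B D))
    (hquad' : QuadraticEstimate k (mulOp (ContinuousLinearMap.adjoint B) D)) :
    ∃ K : ℝ, ∀ a b : ℝ, 0 < a → a ≤ b →
      ‖∫ t in a..b, t⁻¹ • resQ R (t ^ k) ^ 3‖ ≤ K := by
  obtain ⟨C, hC0, hC⟩ := h.exists_integral_bound hk hquad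
  obtain ⟨C', hC0', hC'⟩ := h'.exists_integral_bound hk hquad'
  set B' := ContinuousLinearMap.adjoint B
  refine ⟨_, fun a b ha hab => norm_intervalIntegral_pow_le
    (C' := δ⁻¹ ^ 2 * (C' * ‖B'‖ ^ 2))
    (h.isCauchyPair hk).continuousOn_q (fun t ht => h.norm_resQ_le (pow_pos ht k).ne')
    -- The majorant of `q* x` from `norm_adjoint_resQ_le`; its square function is bounded by the
    -- hypothesis on `B*` applied to `B* x`.
    (g := fun x t => δ⁻¹ • resQ R' (t ^ k) (B' x)) (fun x => ?_) (fun x t ht => ?_) hC0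
    (by positivity) ha hab (hC a b ha hab) (fun x => ?_)⟩
  · exact ((h'.isCauchyPair hk).continuousOn_q.clm_apply continuousOn_const).const_smul _
  · rw [norm_smul, Real.norm_of_nonneg (by positivity)]
    exact norm_adjoint_resQ_le hD hδ hB h h' (pow_pos ht k).ne' x
  · have e : ∀ t : ℝ, t⁻¹ * ‖δ⁻¹ • resQ R' (t ^ k) (B' x)‖ ^ 2 =
        δ⁻¹ ^ 2 * (t⁻¹ * ‖resQ R' (t ^ k) (B' x)‖ ^ 2) := fun t => by
      rw [norm_smul, Real.norm_of_nonneg (by positivity)]; ring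
    simp only [e]
    rw [intervalIntegral.integral_const_mul]
    calc _ ≤ δ⁻¹ ^ 2 * (C' * ‖B' x‖ ^ 2) := by gcongr; exact hC' a b ha hab _
      _ ≤ δ⁻¹ ^ 2 * (C' * (‖B'‖ * ‖x‖) ^ 2) := by gcongr; exact B'.le_opNorm x
      _ = _ := by ring

end Perturbation

/-! ### Passage to the limit and the exponential of `iπS` -/

namespace IsResolventFamily

variable {T : H →ₗ.[ℂ] H} {R : ℝ → H →L[ℂ] H} {M : ℝ} {k : ℕ}

lemma tendsto_intervalIntegral (h : IsResolventFamily T R M) (hk : 1 ≤ k) {f : H}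
    (hf : f ∈ nul T ⊔ (T.domain ⊓ ran T)) {a b : ℕ → ℝ} (ha : ∀ n, 0 < a n) (hab : ∀ n, a n ≤ b n)
    (ha0 : Tendsto a atTop (𝓝 0)) (hb : Tendsto b atTop atTop) :
    Tendsto (fun n => (∫ t in (a n)..(b n), t⁻¹ • resQ R (t ^ k) ^ 3) f) atTop
      (𝓝 (∫ t in Ioi (0 : ℝ), (t⁻¹ • resQ R (t ^ k) ^ 3) f)) := by
  have hcov : AECover (volume.restrict (Ioi (0 : ℝ))) atTop fun n => Ioc (a n) (b n) :=
    (aecover_Ioi_of_Ioi ha0).inter ((aecover_Iic hb).mono Measure.restrict_le_self)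
  have h1 := hcov.integral_tendsto_of_countably_generated (h.integrableOn hk hf)
  refine h1.congr fun n => ?_
  have hs : uIcc (a n) (b n) ⊆ Ioi 0 :=
    IsCauchyPair.uIcc_subset (ha n) ((ha n).trans_le (hab n))
  have h2 := (ContinuousLinearMap.apply ℂ H f).intervalIntegral_comp_comm
    (((h.isCauchyPair hk).continuousOn_inv_smul_pow.mono hs).intervalIntegrable (μ := volume))
  refine Eq.trans ?_ h2
  rw [intervalIntegral.integral_of_le (hab n), Measure.restrict_restrict measurableSet_Ioc]
  congr 2
  exact inter_eq_left.2 fun t ht => (ha n).trans ht.1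

/-- The bounded extension of `sgnCore`. -/
lemma exists_extension (h : IsResolventFamily T R M) (hk : 1 ≤ k)
    (hd : Dense ((nul T ⊔ (T.domain ⊓ ran T) : Submodule ℂ H) : Set H)) {K : ℝ}
    (hK : ∀ a b : ℝ, 0 < a → a ≤ b → ‖∫ t in a..b, t⁻¹ • resQ R (t ^ k) ^ 3‖ ≤ K) :
    ∃ S : H →L[ℂ] H, (∀ x : (sgnCore k T).domain, sgnCore k T x = S x) ∧
      (∀ x, S x ∈ (ran T).topologicalClosure) ∧
      ∀ (x : H) (a b : ℕ → ℝ), (∀ n, 0 < a n) → (∀ n, a n ≤ b n) → Tendsto a atTop (𝓝 0) →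
        Tendsto b atTop atTop →
        Tendsto (fun n => (∫ t in (a n)..(b n), t⁻¹ • resQ R (t ^ k) ^ 3) x) atTop
          (𝓝 (((sgnConst k)⁻¹ : ℝ) • S x)) := by
  have hc : 0 < sgnConst k := by rw [sgnConst_eq hk]; positivity
  have hdom := h.domain_sgnCore hk
  have hbound : ∀ f ∈ nul T ⊔ (T.domain ⊓ ran T),
      ‖∫ t in Ioi (0 : ℝ), (t⁻¹ • resQ R (t ^ k) ^ 3) f‖ ≤ K * ‖f‖ := by
    intro f hf
    have ha : ∀ n : ℕ, (0 : ℝ) < 1 / ((n : ℝ) + 1) := fun n => by positivity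
    have hab : ∀ n : ℕ, 1 / ((n : ℝ) + 1) ≤ (n : ℝ) + 1 := fun n => by
      have : (1 : ℝ) ≤ (n : ℝ) + 1 := by simp
      exact (div_le_one_of_le₀ this (by positivity)).trans this
    have := h.tendsto_intervalIntegral hk hf ha hab tendsto_one_div_add_atTop_nhds_zero_nat
      (tendsto_atTop_add_const_right _ _ tendsto_natCast_atTop_atTop)
    exact le_of_tendsto this.norm (Eventually.of_forall fun n =>
      ContinuousLinearMap.le_of_opNorm_le _ (hK _ _ (ha n) (hab n)) f)
  let S₀ : (sgnCore k T).domain →L[ℂ] H := (sgnCore k T).toFun.mkContinuous (sgnConst k * K)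
    fun f => by
      refine (congrArg norm (h.sgnCore_apply f)).le.trans ?_
      rw [norm_smul, Complex.norm_real, Real.norm_of_nonneg hc.le, mul_assoc]
      exact mul_le_mul_of_nonneg_left (hbound f f.2.1) hc.le
  have hdr : DenseRange (sgnCore k T).domain.subtypeL := by
    have : range (sgnCore k T).domain.subtypeL = ((sgnCore k T).domain : Set H) :=
      Subtype.range_coe
    rw [DenseRange, this, hdom]
    exact hd
  set S : H →L[ℂ] H := S₀.extend (sgnCore k T).domain.subtypeL with hS
  have hSx : ∀ x : (sgnCore k T).domain, sgnCore k T x = S x := fun x =>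
    (ContinuousLinearMap.extend_eq S₀ hdr isUniformEmbedding_subtype_val.isUniformInducing x).symm
  have hSf : ∀ f ∈ nul T ⊔ (T.domain ⊓ ran T), S f =
      (sgnConst k : ℂ) • ∫ t in Ioi (0 : ℝ), (t⁻¹ • resQ R (t ^ k) ^ 3) f := by
    intro f hf
    rw [← hdom] at hf
    rw [← hSx ⟨f, hf⟩]
    exact h.sgnCore_apply ⟨f, hf⟩
  refine ⟨S, hSx, fun x => ?_, fun x a b ha hab ha0 hb => ?_⟩
  · have hcl : IsClosed {x | S x ∈ (ran T).topologicalClosure} :=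
      (Submodule.isClosed_topologicalClosure _).preimage S.continuous
    refine closure_minimal (s := ((nul T ⊔ (T.domain ⊓ ran T) : Submodule ℂ H) : Set H))
      (fun f hf => ?_) hcl (hd x)
    change S f ∈ (ran T).topologicalClosure
    rw [hSf f hf]
    refine Submodule.smul_mem _ _ ?_
    -- Closure of the range is tested by orthogonality, so that the inner product passes under the
    -- integral, whose integrand takes values in `R(T)`.
    rw [← Submodule.orthogonal_orthogonal_eq_closure, Submodule.mem_orthogonal]
    intro w hw
    rw [← integral_inner (h.integrableOn hk hf)]
    refine setIntegral_eq_zero_of_forall_eq_zero fun t (ht : 0 < t) => ?_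
    rw [Submodule.mem_orthogonal'] at hw
    refine hw _ ?_
    rw [pow_succ', _root_.smul_apply, ← Complex.coe_smul]
    exact Submodule.smul_mem _ _ (h.resQ_mem_ran (pow_pos ht k).ne' _)
  · refine tendsto_apply_of_mem_closure (A₀ := ((sgnConst k)⁻¹ : ℝ) • S)
      (Eventually.of_forall fun n => hK _ _ (ha n) (hab n)) (fun f hf => ?_) (hd x)
    convert h.tendsto_intervalIntegral hk hf ha hab ha0 hb using 2
    rw [_root_.smul_apply, hSf f hf, Complex.coe_smul, inv_smul_smul₀ hc.ne']

/-- On the closure of the range, `exp (iπ S) = -I` for the bounded extension `S` of `sgnCore`. -/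
lemma exp_smul_apply_eq_neg (h : IsResolventFamily T R M) (hT : Dense (T.domain : Set H))
    (hk : 1 ≤ k) {K : ℝ}
    (hK : ∀ a b : ℝ, 0 < a → a ≤ b → ‖∫ t in a..b, t⁻¹ • resQ R (t ^ k) ^ 3‖ ≤ K)
    {S : H →L[ℂ] H} (hSY : ∀ x, S x ∈ (ran T).topologicalClosure)
    (hS : ∀ (x : H) (a b : ℕ → ℝ), (∀ n, 0 < a n) → (∀ n, a n ≤ b n) → Tendsto a atTop (𝓝 0) →
      Tendsto b atTop atTop →
      Tendsto (fun n => (∫ t in (a n)..(b n), t⁻¹ • resQ R (t ^ k) ^ 3) x) atTop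
        (𝓝 (((sgnConst k)⁻¹ : ℝ) • S x)))
    {y : H} (hy : y ∈ (ran T).topologicalClosure) :
    NormedSpace.exp ((I * Real.pi : ℂ) • S) y = -y := by
  have hM := h.nonneg
  have hpair := h.isCauchyPair hk
  set q : ℝ → H →L[ℂ] H := fun t => resQ R (t ^ k) with hq
  set p : ℝ → H →L[ℂ] H := fun t => resP R (t ^ k) with hp
  set a : ℕ → ℝ := fun n => 1 / ((n : ℝ) + 1)
  set b : ℕ → ℝ := fun n => (n : ℝ) + 1
  have ha : ∀ n, 0 < a n := fun n => by positivity
  have hb : ∀ n, 0 < b n := fun n => by positivity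
  have hab : ∀ n, a n ≤ b n := fun n => by
    have : (1 : ℝ) ≤ (n : ℝ) + 1 := by simp
    exact (div_le_one_of_le₀ this (by positivity)).trans this
  have ha0 : Tendsto a atTop (𝓝 0) := tendsto_one_div_add_atTop_nhds_zero_nat
  have hbt : Tendsto b atTop atTop :=
    tendsto_atTop_add_const_right _ _ tendsto_natCast_atTop_atTop
  have hka : ∀ n, a n ^ k ≠ 0 := fun n => (pow_pos (ha n) k).ne'
  have hkb : ∀ n, b n ^ k ≠ 0 := fun n => (pow_pos (hb n) k).ne'
  have hka0 : Tendsto (fun n => a n ^ k) atTop (𝓝 0) := by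
    have := ha0.pow k
    rwa [zero_pow (by omega)] at this
  have hkbt : Tendsto (fun n => |b n ^ k|) atTop atTop :=
    tendsto_abs_atTop_atTop.comp ((tendsto_pow_atTop (by omega)).comp hbt)
  have hRa : ∀ x, Tendsto (fun n => R (a n ^ k) x) atTop (𝓝 x) :=
    h.tendsto_zero hT (Eventually.of_forall hka) hka0
  have hRa' : ∀ x, Tendsto (fun n => R (-a n ^ k) x) atTop (𝓝 x) :=
    h.tendsto_zero hT (Eventually.of_forall fun n => neg_ne_zero.2 (hka n))
      (by simpa using hka0.neg)
  have hRb : ∀ y ∈ (ran T).topologicalClosure,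
      Tendsto (fun n => R (b n ^ k) y) atTop (𝓝 0) := fun y hy =>
    h.tendsto_atTop (Eventually.of_forall hkb) hkbt hy
  have hRb' : ∀ y ∈ (ran T).topologicalClosure,
      Tendsto (fun n => R (-b n ^ k) y) atTop (𝓝 0) := fun y hy =>
    h.tendsto_atTop (Eventually.of_forall fun n => neg_ne_zero.2 (hkb n))
      (by simpa only [abs_neg] using hkbt) hy
  have hqa : ∀ y, Tendsto (fun n => q (a n) y) atTop (𝓝 0) := fun y => by
    simpa [hq, resQ] using ((hRa' y).sub (hRa y)).const_smul (2 * I : ℂ)⁻¹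
  have hqb : ∀ y ∈ (ran T).topologicalClosure, Tendsto (fun n => q (b n) y) atTop (𝓝 0) :=
    fun y hy => by
      simpa [hq, resQ] using ((hRb' y hy).sub (hRb y hy)).const_smul (2 * I : ℂ)⁻¹
  set W : ℝ → H →L[ℂ] H := fun t => (2 : ℝ) • q t - (4 : ℝ) • (p t * q t) with hW
  have hWt : ∀ (r : ℕ → ℝ), (∀ n, 0 < r n) → ∀ y, Tendsto (fun n => q (r n) y) atTop (𝓝 0) →
      Tendsto (fun n => W (r n) y) atTop (𝓝 0) := fun r hr y hqy => by
    have h1 : Tendsto (fun n => p (r n) (q (r n) y)) atTop (𝓝 0) := by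
      refine squeeze_zero_norm (fun n => (p (r n)).le_of_opNorm_le
        (h.norm_resP_le (pow_pos (hr n) k).ne') _) ?_
      simpa using hqy.norm.const_mul M
    simpa [hW] using (hqy.const_smul (2 : ℝ)).sub (h1.const_smul (4 : ℝ))
  have hWn : ∀ t, 0 < t → ‖W t‖ ≤ 2 * M + 4 * (M * M) := fun t ht => by
    have h1 := h.norm_resQ_le (pow_pos ht k).ne'
    have h2 := h.norm_resP_le (pow_pos ht k).ne'
    refine (norm_sub_le _ _).trans ?_
    rw [norm_smul, norm_smul, Real.norm_ofNat, Real.norm_ofNat]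
    gcongr
    exact (norm_mul_le _ _).trans (by gcongr)
  set X : ℕ → H →L[ℂ] H := fun n => (2 * I * (k : ℝ) : ℂ) • ∫ t in (a n)..(b n), t⁻¹ • q t with hX
  -- The integrals of `q dt/t` have no direct bound from the hypotheses; both their uniform bound
  -- and their strong limit are read off from the cubic integrals and the boundary terms `W`.
  have hX' : ∀ n, X n = I • ((16 * (k : ℝ)) • (∫ t in (a n)..(b n), t⁻¹ • q t ^ 3) -
      W (b n) + W (a n)) := fun n => by
    rw [hpair.intervalIntegral_pow_eq (ha n) (hb n), hX]
    simp only [hW, ← Complex.coe_smul]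
    push_cast
    module
  have hXn : ∀ n, ‖X n‖ ≤ 16 * k * K + (2 * M + 4 * (M * M)) + (2 * M + 4 * (M * M)) := fun n => by
    rw [hX' n, norm_smul, norm_I, one_mul]
    refine (norm_add_le _ _).trans (add_le_add ((norm_sub_le _ _).trans (add_le_add ?_
      (hWn _ (hb n)))) (hWn _ (ha n)))
    rw [norm_smul, Real.norm_of_nonneg (by positivity)]
    gcongr
    exact hK _ _ (ha n) (hab n)
  have hXt : ∀ y ∈ (ran T).topologicalClosure,
      Tendsto (fun n => X n y) atTop (𝓝 (((I * Real.pi : ℂ) • S) y)) := fun y hy => by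
    have h1 := ((((hS y a b ha hab ha0 hbt).const_smul (16 * (k : ℝ))).sub
      (hWt b hb y (hqb y hy))).add (hWt a ha y (hqa y))).const_smul I
    -- Here `16k` times the inverse normalising constant is exactly `π`.
    have e : I • ((16 * (k : ℝ)) • ((sgnConst k)⁻¹ : ℝ) • S y - 0 + 0) =
        ((I * Real.pi : ℂ) • S) y := by
      have hk0 : (k : ℝ) ≠ 0 := by positivity
      rw [sub_zero, add_zero, smul_smul, sgnConst_eq hk,
        show 16 * (k : ℝ) * (16 * k / Real.pi)⁻¹ = Real.pi by field_simp, ← Complex.coe_smul,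
        smul_smul]
      rfl
    rw [e] at h1
    refine h1.congr fun n => ?_
    rw [hX' n]
    rfl
  have hlim1 := tendsto_exp_apply hXn (Y := ((ran T).topologicalClosure : Set H))
    (fun y _ => Submodule.smul_mem _ _ (hSY y)) hXt hy
  -- `p + iq = R (-s)`, so the Cayley transform is `2 R (-s) - I`, with inverse `2 R s - I`.
  have hU : ∀ t, (2 : ℝ) • (p t + I • q t) - 1 = (2 : ℝ) • R (-t ^ k) - 1 := fun t => by
    congr 2
    simp only [hp, hq, resP, resQ, smul_smul]
    rw [show I * (2 * I : ℂ)⁻¹ = 2⁻¹ by have := I_ne_zero; field_simp]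
    module
  -- The transform at `b n` acts on a vector that varies with `n`. Splitting off `y` leaves an error
  -- tending to `0`, handled by the uniform resolvent bound, and the fixed vector `y`, on which
  -- strong convergence applies.
  have hexp : ∀ n, NormedSpace.exp (X n) y =
      (2 : ℝ) • R (-b n ^ k) ((2 : ℝ) • R (a n ^ k) y - y - y) -
        ((2 : ℝ) • R (a n ^ k) y - y - y) + ((2 : ℝ) • R (-b n ^ k) y - y) := fun n => by
    have h1 := hpair.exp_intervalIntegral_mul (ha n) (hab n)
    rw [hU, hU] at h1
    have h2 : NormedSpace.exp (X n) =
        ((2 : ℝ) • R (-b n ^ k) - 1) * ((2 : ℝ) • R (a n ^ k) - 1) := by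
      rw [← h1, mul_assoc, h.cayley_mul_cayley (hka n), mul_one]
    rw [h2]
    change (2 : ℝ) • R (-b n ^ k) ((2 : ℝ) • R (a n ^ k) y - y) -
      ((2 : ℝ) • R (a n ^ k) y - y) = _
    generalize (2 : ℝ) • R (a n ^ k) y - y = z
    rw [map_sub _ z y, smul_sub]
    abel
  have hz : Tendsto (fun n => (2 : ℝ) • R (a n ^ k) y - y - y) atTop (𝓝 0) := by
    have := (((hRa y).const_smul (2 : ℝ)).sub_const y).sub_const y
    rwa [two_smul, add_sub_cancel_right, sub_self] at this
  have hz' : Tendsto (fun n => R (-b n ^ k) ((2 : ℝ) • R (a n ^ k) y - y - y)) atTop (𝓝 0) := by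
    refine squeeze_zero_norm (fun n => h.norm_apply_le (neg_ne_zero.2 (hkb n)) _) ?_
    simpa using hz.norm.const_mul M
  have hlim2 : Tendsto (fun n => NormedSpace.exp (X n) y) atTop (𝓝 (-y)) := by
    have := ((hz'.const_smul (2 : ℝ)).sub hz).add (((hRb' y hy).const_smul (2 : ℝ)).sub_const y)
    simp only [smul_zero, sub_zero, zero_sub, zero_add] at this
    exact this.congr fun n => (hexp n).symm
  exact tendsto_nhds_unique hlim1 hlim2

end IsResolventFamily

/-- If `exp (iπ S) = -I` on an invariant subspace, then `S` is invertible there. -/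
lemma isUnit_of_exp_smul_eq_neg {E : Type*} [NormedAddCommGroup E] [NormedSpace ℂ E]
    [CompleteSpace E] {S : H →L[ℂ] H} {S' : E →L[ℂ] E} {J : E →L[ℂ] H}
    (hJ : Function.Injective J) (hS : ∀ y, J (S' y) = S (J y))
    (hexp : ∀ y, NormedSpace.exp ((I * Real.pi : ℂ) • S) (J y) = -J y) : IsUnit S' := by
  have hc : (I * Real.pi : ℂ) ≠ 0 := mul_ne_zero I_ne_zero (by exact_mod_cast Real.pi_ne_zero)
  have h1 : NormedSpace.exp ((I * Real.pi : ℂ) • S') = -1 := by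
    ext y
    refine hJ ?_
    rw [apply_exp_of_intertwining (A := (I * Real.pi : ℂ) • S) (fun y => ?_) y, hexp, ← map_neg]
    · rfl
    · rw [_root_.smul_apply, map_smul, hS, _root_.smul_apply]
  have h4 := ((IsUnit.mk0 _ (inv_ne_zero hc)).map (algebraMap ℂ (E →L[ℂ] E))).mul
    (isUnit_of_exp_eq_neg_one h1)
  rwa [← Algebra.smul_def, inv_smul_smul₀ hc] at h4

/-- A bounded operator preserving `Y` with `exp (iπ S) = -I` on `Y` is invertible on `Y`. -/
lemma exists_equiv_of_exp_smul_eq_neg (Y : Submodule ℂ H) [CompleteSpace Y] {S : H →L[ℂ] H}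
    (hSY : ∀ y : Y, S y ∈ Y)
    (hexp : ∀ y : Y, NormedSpace.exp ((I * Real.pi : ℂ) • S) (y : H) = -y) :
    ∃ E : Y ≃L[ℂ] Y, ∀ f : Y, S f = E f := by
  obtain ⟨u, hu⟩ := isUnit_of_exp_smul_eq_neg (S' := (S ∘L Y.subtypeL).codRestrict Y hSY)
    (J := Y.subtypeL) Subtype.val_injective (fun _ => rfl) hexp
  refine ⟨ContinuousLinearEquiv.unitsEquiv ℂ Y u, fun f => ?_⟩
  change S f = ((u : Y →L[ℂ] Y) f : H)
  rw [hu]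
  rfl

end SgnBD

theorem proposition1p2 {H : Type*} [NormedAddCommGroup H] [InnerProductSpace ℂ H]
    [CompleteSpace H] (k : ℕ) (hk : 1 ≤ k) (D : H →ₗ.[ℂ] H) (B : H →L[ℂ] H)
    (hD : IsSelfAdjoint D) (hB : SgnBD.StrictlyAccretiveOnRange B D)
    (hquad : SgnBD.QuadraticEstimate k (SgnBD.mulOp B D))
    (hquad' : SgnBD.QuadraticEstimate k (SgnBD.mulOp (ContinuousLinearMap.adjoint B) D)) :
    ∃ S : H →L[ℂ] H,
      -- `sgn(BD)` is the bounded, everywhere defined operator `S`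
      SgnBD.sgn k (SgnBD.mulOp B D) = (S : H →ₗ[ℂ] H).toPMap ⊤ ∧
      -- and `S` restricts to an isomorphism of the closure of the range of `BD` onto itself
      ∃ E : (SgnBD.ran (SgnBD.mulOp B D)).topologicalClosure ≃L[ℂ]
          (SgnBD.ran (SgnBD.mulOp B D)).topologicalClosure,
        ∀ f : (SgnBD.ran (SgnBD.mulOp B D)).topologicalClosure, S f = E f := by
  obtain ⟨δ, hδ, hacc⟩ := hB
  have hB' := SgnBD.accretiveWith_of_forall hacc
  obtain ⟨R, h⟩ := SgnBD.exists_isResolventFamily hD hδ hB'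
  obtain ⟨R', h'⟩ := SgnBD.exists_isResolventFamily hD hδ hB'.adjoint
  have hdense := SgnBD.dense_nul_sup hD hδ hB' h
  obtain ⟨K, hK⟩ := SgnBD.exists_norm_intervalIntegral_le hD hδ hB' h h' hk hquad hquad'
  obtain ⟨S, hS, hSY, hlim⟩ := h.exists_extension hk hdense hK
  refine ⟨S, ?_, ?_⟩
  · refine SgnBD.closure_eq_toPMap_of_dense ?_ hS
    rw [h.domain_sgnCore hk]
    exact hdense
  · exact SgnBD.exists_equiv_of_exp_smul_eq_neg _ (fun y => hSY y) fun y =>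
      h.exp_smul_apply_eq_neg hD.dense_domain hk hK hSY hlim y.2
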